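/- \textbf{Setting.} A dynamic network consists of a finite directed graph $(V,E)$ with $E\subseteq V\times V$, a source $s$ and a target $t\neq s$, transit times $\tau_e\ge 0$, and non-negative piecewise constant capacities $u_e\colon\mathbb R\to\mathbb R$ (finitely many pieces). A function $g$ of time \emph{changes} at $\Theta$ if $g(\Theta-\varepsilon)\ne g(\Theta+\varepsilon)$ for all sufficiently small $\varepsilon>0$. A \emph{dynamic flow with considered time interval} $[A,B]$ is a family of measurable functions $f_e\ge 0$ with $f_e=0$ outside $[A,B-\tau_e]$ and $f_e\le u_e$ on $[A,B-\tau_e]$ such that the excess $\mathrm{ex}_f(v,\Theta)=\int_A^\Theta\big(\sum_{e=(w,v)}f_e(\zeta-\tau_e)-\sum_{e=(v,w)}f_e(\zeta)\big)\,d\zeta$ vanishes for all $v\ne s,t$ and $\Theta\in[A,B]$; its value is $\mathrm{ex}_f(t,B)$. A \emph{dynamic cut} on $[A,B]$ is a family of measurable functions $S_v$ with values in $\{0,1\}$ with $S_s=1$ and $S_t=0$ on $[A,B]$, where one sets $S_v(\Theta)=1$ for all $v$ and $\Theta>B$; its capacity is $\int_A^B\sum u_e(\Theta)\,d\Theta$,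 the sum running over the $e=(v,w)\in E$ with $S_v(\Theta)=1$ and $S_w(\Theta+\tau_e)=0$. \emph{Infinite considered time.} A piecewise constant family $f=(f_e)_{e\in E}$ of functions on $\mathbb R$ is a maximum flow with infinite considered time if there is an interval $I=[a,b]$ such that each $f_e$ is constant before $a$ and constant after $b$, and for every interval $J\supseteq I$ there are an interval $K\supseteq J$ and a maximum flow with considered time interval $K$ that equals $f$ on $J$. Minimum cuts with infinite considered time are defined in the same way. Here a function is piecewise constant if it has finitely many pieces and each point lies in an interval of non-zero length on which the function is constant. The \emph{complexity} of a flow (cut) is the total number of changes of its functions $f_e$ ($S_v$). In \emph{discrete time} ($\Theta\in\mathbb Z$, integer transit times) the same notions are used with sums in place of integrals, and a change at $\Theta$ means $g(\Theta-1)\neq g(\Theta)$. \textbf{Statement.} There is a polynomial $p$ such that for every $\ell\in\mathbb N$ there is an acyclic dynamic network with exactly two capacity changes in total, with at most $p(\ell)$ vertices, all of whose transit times, capacities and capacity change times are integers with at most $p(\ell)$ binary digits, and whose capacities are constant on every interval $[n,n+1)$ with $n\in\mathbb Z$, such that, with infinite considered time, minimum cuts and maximum flows exist, every minimum cut has complexity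 at least $2^\ell$, and every maximum flow has complexity at least $2^\ell$. All of this holds for the network in continuous time as well as in discrete time. -/

import Mathlib

open Filter Topology

noncomputable section

/-- A function of time changes at `θ` if its values at `θ - ε` and `θ + ε` differ for every
sufficiently small `ε > 0`. This is the set of all such times. -/
def changeTimes {α : Type} (g : ℝ → α) : Set ℝ :=
  {θ | ∀ᶠ ε in 𝓝[>] (0 : ℝ), g (θ - ε) ≠ g (θ + ε)}

/-- Piecewise constant on the whole time axis: outside finitely many breakpoints the function is
locally constant (so it is constant before the first and after the last breakpoint), and every
point of time lies in an interval of nonzero length on which the function is constant. -/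
def IsPiecewiseConstant {α : Type} (g : ℝ → α) : Prop :=
  (∃ P : Finset ℝ, ∀ x y, x ≤ y → (∀ p ∈ P, p ∉ Set.Icc x y) → g x = g y) ∧
  ∀ x, (∀ᶠ y in 𝓝[<] x, g y = g x) ∨ (∀ᶠ y in 𝓝[>] x, g y = g x)

/-- `g` is constant before `a` and constant after `b` (possibly with two different values). -/
def ConstantOutside {T α : Type} [LT T] (g : T → α) (a b : T) : Prop :=
  (∀ x y, x < a → y < a → g x = g y) ∧ (∀ x y, b < x → b < y → g x = g y)

/-- A dynamic network on the vertex set `V` with time-dependent piecewise constant capacities and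
constant transit times. The values of `transit` and `cap` matter on `edges` only. -/
structure DynamicNetwork (V : Type) where
  source : V
  target : V
  source_ne_target : source ≠ target
  edges : Finset (V × V)
  transit : V × V → ℝ
  transit_nonneg : ∀ e ∈ edges, 0 ≤ transit e
  cap : V × V → ℝ → ℝ
  cap_nonneg : ∀ e ∈ edges, ∀ θ, 0 ≤ cap e θ
  cap_piecewiseConstant : ∀ e ∈ edges, IsPiecewiseConstant (cap e)

namespace DynamicNetwork

variable {V : Type} (N : DynamicNetwork V)

/-- There is no directed cycle (in particular no loop). -/
def IsAcyclic : Prop :=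
  ∀ v, ¬ Relation.TransGen (fun x y => (x, y) ∈ N.edges) v v

/-- The total number of capacity changes, over all edges. -/
def numCapacityChanges : ℕ∞ :=
  ∑ e ∈ N.edges, (changeTimes (N.cap e)).encard

/-- The network lives on the time grid `ℤ`: transit times are integers, and all capacities are
constant on every interval `[n, n + 1)` with `n` an integer. -/
def IsDiscrete : Prop :=
  (∀ e ∈ N.edges, ∃ m : ℤ, N.transit e = m) ∧
  ∀ e ∈ N.edges, ∀ θ : ℝ, N.cap e θ = N.cap e (⌊θ⌋ : ℝ)

/-- The network has at most `b` vertices, and all numbers describing it (transit times,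
capacities, times of capacity changes) are integers with at most `b` binary digits. -/
def HasSizeAtMost [Fintype V] (b : ℕ) : Prop :=
  Fintype.card V ≤ b ∧
  ∀ e ∈ N.edges,
    (∃ m : ℕ, N.transit e = m ∧ m.size ≤ b) ∧
    (∀ θ, ∃ m : ℕ, N.cap e θ = m ∧ m.size ≤ b) ∧
    (∀ θ ∈ changeTimes (N.cap e), ∃ m : ℤ, θ = m ∧ m.natAbs.size ≤ b)

/-! ### Continuous time, considered time interval `[A, B]` -/

section Continuous

variable [DecidableEq V]

/-- The excess of `v` at time `θ` when time is considered from `A` on. -/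
def excess (A : ℝ) (f : V × V → ℝ → ℝ) (v : V) (θ : ℝ) : ℝ :=
  ∫ ζ in A..θ, ((∑ e ∈ N.edges with e.2 = v, f e (ζ - N.transit e)) -
    ∑ e ∈ N.edges with e.1 = v, f e ζ)

/-- Dynamic flows with considered time interval `[A, B]`, extended by zero. -/
structure IsFlow (A B : ℝ) (f : V × V → ℝ → ℝ) : Prop where
  measurable : ∀ e ∈ N.edges, Measurable (f e)
  zero_outside : ∀ e ∈ N.edges, ∀ θ, θ ∉ Set.Icc A (B - N.transit e) → f e θ = 0
  nonneg : ∀ e ∈ N.edges, ∀ θ, 0 ≤ f e θ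
  le_cap : ∀ e ∈ N.edges, ∀ θ ∈ Set.Icc A (B - N.transit e), f e θ ≤ N.cap e θ
  conservation : ∀ v, v ≠ N.source → v ≠ N.target → ∀ θ ∈ Set.Icc A B, N.excess A f v θ = 0

/-- A flow of maximum value, the value being the excess of the target at time `B`. -/
def IsMaxFlow (A B : ℝ) (f : V × V → ℝ → ℝ) : Prop :=
  N.IsFlow A B f ∧
    ∀ g, N.IsFlow A B g → N.excess A g N.target B ≤ N.excess A f N.target B

end Continuous

/-- Dynamic cuts with considered time interval `[A, B]`; `S v θ = true` means that `v` belongs to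
the source side at time `θ`. -/
structure IsCut (A B : ℝ) (S : V → ℝ → Bool) : Prop where
  measurable : ∀ v, Measurable (S v)
  source_mem : ∀ θ ∈ Set.Icc A B, S N.source θ = true
  target_notMem : ∀ θ ∈ Set.Icc A B, S N.target θ = false

/-- The capacity of a cut, where every vertex counts as being on the source side after time `B`.
-/
def cutCapacity (A B : ℝ) (S : V → ℝ → Bool) : ℝ :=
  ∫ θ in A..B, ∑ e ∈ N.edges with (θ > B ∨ S e.1 θ = true) ∧
    ¬ (θ + N.transit e > B ∨ S e.2 (θ + N.transit e) = true), N.cap e θ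

def IsMinCut (A B : ℝ) (S : V → ℝ → Bool) : Prop :=
  N.IsCut A B S ∧ ∀ R, N.IsCut A B R → N.cutCapacity A B S ≤ N.cutCapacity A B R

/-! ### Continuous time, infinite considered time -/

/-- Maximum flows with infinite considered time: constant outside some interval `[a, b]`, and for
every larger interval `[a', b']` there is a still larger interval `[A, B]` such that some maximum
flow with considered time interval `[A, B]` is equal to `f` during `[a', b']`. -/
def IsMaxFlowInfinite [DecidableEq V] (f : V × V → ℝ → ℝ) : Prop :=
  (∀ e ∈ N.edges, IsPiecewiseConstant (f e)) ∧
  ∃ a b : ℝ, a ≤ b ∧ (∀ e ∈ N.edges, ConstantOutside (f e) a b) ∧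
    ∀ a' b', a' ≤ a → b ≤ b' → ∃ A B, A ≤ a' ∧ b' ≤ B ∧
      ∃ g, N.IsMaxFlow A B g ∧ ∀ e ∈ N.edges, ∀ θ ∈ Set.Icc a' b', g e θ = f e θ

/-- Minimum cuts with infinite considered time. -/
def IsMinCutInfinite (S : V → ℝ → Bool) : Prop :=
  (∀ v, IsPiecewiseConstant (S v)) ∧
  ∃ a b : ℝ, a ≤ b ∧ (∀ v, ConstantOutside (S v) a b) ∧
    ∀ a' b', a' ≤ a → b ≤ b' → ∃ A B, A ≤ a' ∧ b' ≤ B ∧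
      ∃ R, N.IsMinCut A B R ∧ ∀ v, ∀ θ ∈ Set.Icc a' b', R v θ = S v θ

/-- The complexity of a flow: its total number of changes on edges. -/
def flowComplexity (f : V × V → ℝ → ℝ) : ℕ∞ :=
  ∑ e ∈ N.edges, (changeTimes (f e)).encard

/-! ### Discrete time

The same notions with time steps in `ℤ` and sums in place of integrals. They are meant for
networks with `N.IsDiscrete`, whose transit times are integers. -/

/-- The transit time as a number of time steps. -/
def transitSteps (e : V × V) : ℤ := ⌊N.transit e⌋

section Discrete

variable [DecidableEq V]

def dExcess (A : ℤ) (f : V × V → ℤ → ℝ) (v : V) (θ : ℤ) : ℝ :=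
  ∑ ζ ∈ Finset.Icc A θ, ((∑ e ∈ N.edges with e.2 = v, f e (ζ - N.transitSteps e)) -
    ∑ e ∈ N.edges with e.1 = v, f e ζ)

/-- Discrete-time flows with considered time steps `A, …, B`, extended by zero. -/
structure IsDFlow (A B : ℤ) (f : V × V → ℤ → ℝ) : Prop where
  zero_outside : ∀ e ∈ N.edges, ∀ θ, θ ∉ Set.Icc A (B - N.transitSteps e) → f e θ = 0
  nonneg : ∀ e ∈ N.edges, ∀ θ, 0 ≤ f e θ
  le_cap : ∀ e ∈ N.edges, ∀ θ ∈ Set.Icc A (B - N.transitSteps e), f e θ ≤ N.cap e θ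
  conservation : ∀ v, v ≠ N.source → v ≠ N.target → ∀ θ ∈ Set.Icc A B, N.dExcess A f v θ = 0

def IsMaxDFlow (A B : ℤ) (f : V × V → ℤ → ℝ) : Prop :=
  N.IsDFlow A B f ∧
    ∀ g, N.IsDFlow A B g → N.dExcess A g N.target B ≤ N.dExcess A f N.target B

end Discrete

structure IsDCut (A B : ℤ) (S : V → ℤ → Bool) : Prop where
  source_mem : ∀ θ ∈ Set.Icc A B, S N.source θ = true
  target_notMem : ∀ θ ∈ Set.Icc A B, S N.target θ = false

def dCutCapacity (A B : ℤ) (S : V → ℤ → Bool) : ℝ :=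
  ∑ θ ∈ Finset.Icc A B, ∑ e ∈ N.edges with (θ > B ∨ S e.1 θ = true) ∧
    ¬ (θ + N.transitSteps e > B ∨ S e.2 (θ + N.transitSteps e) = true), N.cap e θ

def IsMinDCut (A B : ℤ) (S : V → ℤ → Bool) : Prop :=
  N.IsDCut A B S ∧ ∀ R, N.IsDCut A B R → N.dCutCapacity A B S ≤ N.dCutCapacity A B R

def IsMaxDFlowInfinite [DecidableEq V] (f : V × V → ℤ → ℝ) : Prop :=
  ∃ a b : ℤ, a ≤ b ∧ (∀ e ∈ N.edges, ConstantOutside (f e) a b) ∧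
    ∀ a' b', a' ≤ a → b ≤ b' → ∃ A B, A ≤ a' ∧ b' ≤ B ∧
      ∃ g, N.IsMaxDFlow A B g ∧ ∀ e ∈ N.edges, ∀ θ ∈ Set.Icc a' b', g e θ = f e θ

def IsMinDCutInfinite (S : V → ℤ → Bool) : Prop :=
  ∃ a b : ℤ, a ≤ b ∧ (∀ v, ConstantOutside (S v) a b) ∧
    ∀ a' b', a' ≤ a → b ≤ b' → ∃ A B, A ≤ a' ∧ b' ≤ B ∧
      ∃ R, N.IsMinDCut A B R ∧ ∀ v, ∀ θ ∈ Set.Icc a' b', R v θ = S v θ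

end DynamicNetwork

/-- The time steps at which a function of discrete time changes its value. -/
def dChangeTimes {α : Type} (g : ℤ → α) : Set ℤ :=
  {θ | g (θ - 1) ≠ g θ}

/-- The complexity of a cut: its total number of partition changes. -/
def cutComplexity {V : Type} [Fintype V] (S : V → ℝ → Bool) : ℕ∞ :=
  ∑ v, (changeTimes (S v)).encard

def dCutComplexity {V : Type} [Fintype V] (S : V → ℤ → Bool) : ℕ∞ :=
  ∑ v, (dChangeTimes (S v)).encard

def DynamicNetwork.dFlowComplexity {V : Type} (N : DynamicNetwork V) (f : V × V → ℤ → ℝ) : ℕ∞ :=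
  ∑ e ∈ N.edges, (dChangeTimes (f e)).encard

end

/-! A binary delay line stretches a short burst into exponentially many pulses. Stage `i` joins
vertex `2i+1` to `2i+3` by an instantaneous route and by one with delay `2^(i+1)`. The routes chosen
are the binary digits of the arrival time, so flow leaving the source in step `0` can reach the last
inner vertex exactly at the `2^ℓ` even steps below `2^(ℓ+1)`. The last edge passes one unit per
step, and every other edge, when open, has capacity `2^ℓ + 1` and is no bottleneck.

Flows: tracing positive flow backwards shows that the last edge is usable at arrival times only
(`arrival_of_flow_ne_zero`). Hence `optFlow` dominates every flow pointwise on that edge, so it is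
maximum and every maximum flow agrees with it there.

Cuts: if no edge of capacity `2^ℓ + 1` is cut, the source side propagates forward to all arrivals
and the last edge is cut at each of them. Either way the capacity is at least `2^ℓ`, and equality
determines the last inner vertex on the whole window `[0, 2^(ℓ+1))` (`sum_cutStep`). Both optima
thus alternate at every step of the window, whatever large interval is considered.

Continuous time: delays are integers, so each coset `φ + ℤ` carries a discrete instance.
`integral_zero_natCast` integrates the discrete cut bound over the phase `φ`, and
`ae_forall_add_int` makes flow conservation available on whole cosets. Piecewise constancy then
turns almost-everywhere agreement into genuine changes (`IsPiecewiseConstant.mem_changeTimes`). -/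

noncomputable section

/-! ### The delay line and its arrival times. -/

namespace BinaryDelay

/-- Edges of the delay line on the vertices `0, …, 2 * ℓ + 2`: consecutive vertices are joined,
and every odd vertex is joined to the next odd one. -/
def edges (ℓ : ℕ) : Finset (Fin (2 * ℓ + 3) × Fin (2 * ℓ + 3)) :=
  {e | e.2.val = e.1.val + 1 ∨ (e.1.val % 2 = 1 ∧ e.2.val = e.1.val + 2)}

/-- Shortcuts between odd vertices are slow, with delays `2, 4, 8, …`; other edges are instant. -/
def delay {ℓ : ℕ} (e : Fin (2 * ℓ + 3) × Fin (2 * ℓ + 3)) : ℕ :=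
  if e.2.val = e.1.val + 1 then 0 else 2 ^ ((e.1.val + 1) / 2)

/-- The source edge is open during one time step only, the last edge has capacity `1`, and all
other edges have a capacity that exceeds the value of the maximum flow. -/
def stepCap {ℓ : ℕ} (e : Fin (2 * ℓ + 3) × Fin (2 * ℓ + 3)) (n : ℤ) : ℕ :=
  if e.1.val = 0 then (if n = 0 then 2 ^ ℓ + 1 else 0)
  else if e.2.val = 2 * ℓ + 2 then 1 else 2 ^ ℓ + 1

/-- The times at which flow leaving the source at time `0` can reach the vertex `j`. -/
def Arrival (j : ℕ) (n : ℤ) : Prop := n % 2 = 0 ∧ 0 ≤ n ∧ n < 2 ^ ((j + 1) / 2)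

instance (j : ℕ) (n : ℤ) : Decidable (Arrival j n) := by unfold Arrival; infer_instance

variable {ℓ : ℕ}

theorem mem_edges {e : Fin (2 * ℓ + 3) × Fin (2 * ℓ + 3)} : e ∈ edges ℓ ↔
    e.2.val = e.1.val + 1 ∨ (e.1.val % 2 = 1 ∧ e.2.val = e.1.val + 2) := by
  simp [edges]

theorem fst_lt_snd {e : Fin (2 * ℓ + 3) × Fin (2 * ℓ + 3)} (he : e ∈ edges ℓ) :
    e.1.val < e.2.val := by
  rw [mem_edges] at he; omega

/-- The edge into the target. -/
def lastEdge (ℓ : ℕ) : Fin (2 * ℓ + 3) × Fin (2 * ℓ + 3) :=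
  (⟨2 * ℓ + 1, by omega⟩, ⟨2 * ℓ + 2, by omega⟩)

theorem lastEdge_mem : lastEdge ℓ ∈ edges ℓ := by simp [mem_edges, lastEdge]

theorem eq_lastEdge {e : Fin (2 * ℓ + 3) × Fin (2 * ℓ + 3)} (he : e ∈ edges ℓ)
    (h : e.2.val = 2 * ℓ + 2) : e = lastEdge ℓ := by
  rw [mem_edges] at he
  refine Prod.ext (Fin.ext ?_) (Fin.ext ?_) <;> simp only [lastEdge] <;> omega

@[simp] theorem delay_lastEdge : delay (lastEdge ℓ) = 0 := by simp [delay, lastEdge]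

theorem stepCap_lastEdge (n : ℤ) : stepCap (lastEdge ℓ) n = 1 := by simp [stepCap, lastEdge]

theorem delay_le {e : Fin (2 * ℓ + 3) × Fin (2 * ℓ + 3)} (he : e ∈ edges ℓ) :
    delay e ≤ 2 ^ ℓ := by
  rw [mem_edges] at he
  unfold delay
  split_ifs with h
  · exact Nat.zero_le _
  · exact Nat.pow_le_pow_right (by norm_num) (by have := e.2.isLt; omega)

theorem Arrival.mono {i j : ℕ} (h : i ≤ j) {n : ℤ} (hn : Arrival i n) : Arrival j n :=
  ⟨hn.1, hn.2.1, hn.2.2.trans_le (pow_le_pow_right₀ (by norm_num) (by omega))⟩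

theorem arrival_even (i : ℕ) (n : ℤ) : Arrival (2 * i + 2) n ↔ Arrival (2 * i + 1) n := by
  unfold Arrival
  rw [show (2 * i + 2 + 1) / 2 = (2 * i + 1 + 1) / 2 by omega]

theorem arrival_zero (n : ℤ) : Arrival 0 n ↔ n = 0 := by
  simp only [Arrival]; norm_num; omega

theorem arrival_one (n : ℤ) : Arrival 1 n ↔ n = 0 := by
  simp only [Arrival]; norm_num; omega

/-- The even numbers below `2^(i+2)` consist of those below `2^(i+1)` and their shift by the slow
delay: stage `i` appends one binary digit. -/
theorem arrival_odd_succ (i : ℕ) (n : ℤ) : Arrival (2 * i + 3) n ↔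
    Arrival (2 * i + 1) n ∨ Arrival (2 * i + 1) (n - 2 ^ (i + 1)) := by
  unfold Arrival
  rw [show (2 * i + 3 + 1) / 2 = i + 2 by omega, show (2 * i + 1 + 1) / 2 = i + 1 by omega]
  have : (0 : ℤ) < 2 ^ i := by positivity
  -- As a multiple of `2 ^ i * 2` the delay is visibly even, so parity survives the shift.
  rw [pow_succ _ (i + 1), pow_succ _ i]
  omega

/-- The slow delay is at least the length of the arrival window, so the fast and the slow stream
never overlap. -/
theorem Arrival.disjoint {i : ℕ} {n : ℤ} (h : Arrival (2 * i + 1) n) :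
    ¬ Arrival (2 * i + 1) (n - 2 ^ (i + 1)) := by
  unfold Arrival at *
  rw [show (2 * i + 1 + 1) / 2 = i + 1 by omega] at *
  omega

theorem Arrival.nonneg {j : ℕ} {n : ℤ} (h : Arrival j n) : 0 ≤ n := h.2.1

theorem Arrival.lt {j : ℕ} {n : ℤ} (h : Arrival j n) (hj : j < 2 * ℓ + 3) : n < 2 ^ (ℓ + 1) :=
  h.2.2.trans_le (pow_le_pow_right₀ (by norm_num) (by omega))

theorem arrival_last {n : ℤ} (h0 : 0 ≤ n) (h1 : n < 2 ^ (ℓ + 1)) :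
    Arrival (2 * ℓ + 1) n ↔ n % 2 = 0 := by
  unfold Arrival
  rw [show (2 * ℓ + 1 + 1) / 2 = ℓ + 1 by omega]
  tauto

/-- Arrival times propagate along edges. -/
theorem Arrival.step {e : Fin (2 * ℓ + 3) × Fin (2 * ℓ + 3)} (he : e ∈ edges ℓ) {n : ℤ}
    (h : Arrival e.1 n) : Arrival e.2 (n + delay e) := by
  obtain ⟨a, b⟩ := e
  rw [mem_edges] at he
  unfold delay
  simp only at *
  rcases he with he | ⟨h1, he⟩
  · simpa [he] using h.mono (Nat.le_succ _)
  · obtain ⟨i, hi⟩ : ∃ i, a.val = 2 * i + 1 := ⟨a.val / 2, by omega⟩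
    have hb : b.val = 2 * i + 3 := by omega
    rw [hb, hi, arrival_odd_succ]
    right
    rw [hi] at h
    simpa [show (2 * i + 1 + 1) / 2 = i + 1 by omega] using h

/-- Every arrival at an inner vertex comes from an arrival at a predecessor. -/
theorem Arrival.exists_pred {v : Fin (2 * ℓ + 3)} (hv : v.val ≠ 0) {n : ℤ} (h : Arrival v n) :
    ∃ e ∈ edges ℓ, e.2 = v ∧ Arrival e.1 (n - delay e) := by
  have hlt := v.isLt
  rcases Nat.even_or_odd' v.val with ⟨i, hi | hi⟩
  · obtain ⟨j, rfl⟩ : ∃ j, i = j + 1 := ⟨i - 1, by omega⟩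
    refine ⟨(⟨2 * j + 1, by omega⟩, v), by simp [mem_edges]; omega, rfl, ?_⟩
    have : delay (ℓ := ℓ) (⟨2 * j + 1, by omega⟩, v) = 0 := by simp [delay]; omega
    rw [this]
    simpa using (arrival_even j n).1 (by rw [hi] at h; exact h)
  · rcases i with _ | i
    · refine ⟨(⟨0, by omega⟩, v), by simp [mem_edges]; omega, rfl, ?_⟩
      have : delay (ℓ := ℓ) (⟨0, by omega⟩, v) = 0 := by simp [delay]; omega
      rw [this]
      rw [hi] at h
      simpa using (arrival_zero n).2 ((arrival_one n).1 h)
    · rw [hi, show 2 * (i + 1) + 1 = 2 * i + 3 by ring, arrival_odd_succ] at h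
      rcases h with h | h
      · refine ⟨(⟨2 * i + 2, by omega⟩, v), by simp [mem_edges]; omega, rfl, ?_⟩
        have : delay (ℓ := ℓ) (⟨2 * i + 2, by omega⟩, v) = 0 := by simp [delay]; omega
        rw [this]
        simpa using (arrival_even i n).2 h
      · refine ⟨(⟨2 * i + 1, by omega⟩, v), by simp [mem_edges]; omega, rfl, ?_⟩
        have : delay (ℓ := ℓ) (⟨2 * i + 1, by omega⟩, v) = 2 ^ (i + 1) := by
          simp only [delay]
          rw [if_neg (by omega), show (2 * i + 1 + 1) / 2 = i + 1 by omega]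
        rw [this]
        exact_mod_cast h

/-! ### The maximum flow -/

/-- The amount of flow that the maximum flow sends along `e` at time `n`. -/
def optFlow (e : Fin (2 * ℓ + 3) × Fin (2 * ℓ + 3)) (n : ℤ) : ℝ :=
  if Arrival e.1 n then 2 ^ (ℓ - (e.1.val + 1) / 2) else 0

theorem optFlow_nonneg (e : Fin (2 * ℓ + 3) × Fin (2 * ℓ + 3)) (n : ℤ) : 0 ≤ optFlow e n := by
  unfold optFlow; split_ifs <;> positivity

theorem optFlow_le_cap {e : Fin (2 * ℓ + 3) × Fin (2 * ℓ + 3)} (he : e ∈ edges ℓ) (n : ℤ) :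
    optFlow e n ≤ stepCap e n := by
  have key : ∀ k, k ≤ ℓ → (2 : ℝ) ^ k ≤ ((2 ^ ℓ + 1 : ℕ) : ℝ) := by
    intro k hk
    have : (2 : ℝ) ^ k ≤ 2 ^ ℓ := pow_le_pow_right₀ (by norm_num) hk
    push_cast
    linarith
  unfold optFlow
  split_ifs with h
  · unfold stepCap
    split_ifs with h0 hn hl
    · exact key _ (by omega)
    · rw [h0, arrival_zero] at h; exact absurd h hn
    · rw [eq_lastEdge he hl]
      simp [lastEdge, show ℓ - (2 * ℓ + 1 + 1) / 2 = 0 by omega]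
    · exact key _ (by omega)
  · positivity

/-- The truncated subtraction `ℓ - (ℓ + 1) = 0` is intended: the last inner vertex has a single
outgoing edge, so the rate is not halved again. -/
theorem optFlow_lastEdge (n : ℤ) :
    optFlow (lastEdge ℓ) n = if Arrival (2 * ℓ + 1) n then 1 else 0 := by
  simp [optFlow, lastEdge, show ℓ - (2 * ℓ + 1 + 1) / 2 = 0 by omega]

theorem optFlow_ne_zero {e : Fin (2 * ℓ + 3) × Fin (2 * ℓ + 3)} {n : ℤ} (h : optFlow e n ≠ 0) :
    0 ≤ n ∧ n < 2 ^ (ℓ + 1) := by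
  unfold optFlow at h
  split_ifs at h with h'
  · exact ⟨h'.nonneg, h'.lt e.1.isLt⟩
  · exact absurd rfl h

/-- The vertex stars reduce conservation to sums of at most two terms. Odd vertices split and merge
streams; even ones subdivide the fast route, which would otherwise be parallel to the slow one. -/
theorem filter_snd_even {v : Fin (2 * ℓ + 3)} {i : ℕ} (hv : v.val = 2 * i + 2) :
    {e ∈ edges ℓ | e.2 = v} = {(⟨2 * i + 1, by omega⟩, v)} := by
  ext ⟨a, b⟩
  simp only [Finset.mem_filter, mem_edges, Finset.mem_singleton, Prod.mk.injEq, Fin.ext_iff]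
  omega

theorem filter_snd_one {v : Fin (2 * ℓ + 3)} (hv : v.val = 1) :
    {e ∈ edges ℓ | e.2 = v} = {(⟨0, by omega⟩, v)} := by
  ext ⟨a, b⟩
  simp only [Finset.mem_filter, mem_edges, Finset.mem_singleton, Prod.mk.injEq, Fin.ext_iff]
  omega

theorem filter_snd_odd {v : Fin (2 * ℓ + 3)} {i : ℕ} (hv : v.val = 2 * i + 3) :
    {e ∈ edges ℓ | e.2 = v} = {(⟨2 * i + 2, by omega⟩, v), (⟨2 * i + 1, by omega⟩, v)} := by
  ext ⟨a, b⟩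
  simp only [Finset.mem_filter, mem_edges, Finset.mem_singleton, Finset.mem_insert, Prod.mk.injEq,
    Fin.ext_iff]
  omega

theorem filter_fst_even {v : Fin (2 * ℓ + 3)} {i : ℕ} (hv : v.val = 2 * i + 2) (hi : i < ℓ) :
    {e ∈ edges ℓ | e.1 = v} = {(v, ⟨2 * i + 3, by omega⟩)} := by
  ext ⟨a, b⟩
  simp only [Finset.mem_filter, mem_edges, Finset.mem_singleton, Prod.mk.injEq, Fin.ext_iff]
  omega

theorem filter_fst_odd {v : Fin (2 * ℓ + 3)} {i : ℕ} (hv : v.val = 2 * i + 1) (hi : i < ℓ) :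
    {e ∈ edges ℓ | e.1 = v} = {(v, ⟨2 * i + 2, by omega⟩), (v, ⟨2 * i + 3, by omega⟩)} := by
  ext ⟨a, b⟩
  simp only [Finset.mem_filter, mem_edges, Finset.mem_singleton, Finset.mem_insert, Prod.mk.injEq,
    Fin.ext_iff]
  omega

theorem filter_fst_last {v : Fin (2 * ℓ + 3)} (hv : v.val = 2 * ℓ + 1) :
    {e ∈ edges ℓ | e.1 = v} = {(v, ⟨2 * ℓ + 2, by omega⟩)} := by
  ext ⟨a, b⟩
  have := b.isLt
  simp only [Finset.mem_filter, mem_edges, Finset.mem_singleton, Prod.mk.injEq, Fin.ext_iff]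
  omega

theorem filter_snd_target : {e ∈ edges ℓ | e.2 = Fin.last (2 * ℓ + 2)} = {lastEdge ℓ} :=
  filter_snd_even (i := ℓ) rfl

theorem filter_fst_target : {e ∈ edges ℓ | e.1 = Fin.last (2 * ℓ + 2)} = ∅ := by
  refine Finset.filter_eq_empty_iff.2 fun e he h => ?_
  have := fst_lt_snd he
  have := e.2.isLt
  rw [h, Fin.val_last] at *
  omega

theorem sum_optFlow_out_odd {v : Fin (2 * ℓ + 3)} {i : ℕ} (hv : v.val = 2 * i + 1) (n : ℤ) :
    ∑ e ∈ edges ℓ with e.1 = v, optFlow e n =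
      if Arrival (2 * i + 1) n then 2 ^ (ℓ - i) else 0 := by
  rcases lt_or_eq_of_le (show i ≤ ℓ by omega) with hi | rfl
  · rw [filter_fst_odd hv hi, Finset.sum_pair (by simp)]
    simp only [optFlow, hv]
    rw [show (2 * i + 1 + 1) / 2 = i + 1 by omega, show ℓ - i = ℓ - (i + 1) + 1 by omega, pow_succ]
    split_ifs <;> ring
  · rw [filter_fst_last hv, Finset.sum_singleton]
    simp only [optFlow, hv]
    rw [show i - (2 * i + 1 + 1) / 2 = i - i by omega]

/-- Both incoming streams have the same rate and disjoint times, so merging puts one after the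
other: each stage halves the rate and doubles the duration. -/
theorem sum_optFlow_in_odd {v : Fin (2 * ℓ + 3)} {i : ℕ} (hv : v.val = 2 * i + 1) (n : ℤ) :
    ∑ e ∈ edges ℓ with e.2 = v, optFlow e (n - delay e) =
      if Arrival (2 * i + 1) n then 2 ^ (ℓ - i) else 0 := by
  rcases i with _ | i
  · rw [filter_snd_one hv, Finset.sum_singleton]
    simp [optFlow, hv, delay, arrival_zero, arrival_one]
  · have hv' : v.val = 2 * i + 3 := by omega
    rw [filter_snd_odd hv', Finset.sum_pair (by simp)]
    simp only [optFlow, delay, hv', arrival_even, if_true]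
    rw [if_neg (by omega : ¬ 2 * i + 3 = 2 * i + 1 + 1),
      show (2 * i + 1 + 1) / 2 = i + 1 by omega, show (2 * i + 2 + 1) / 2 = i + 1 by omega,
      show 2 * (i + 1) + 1 = 2 * i + 3 by ring]
    simp only [arrival_odd_succ, Nat.cast_zero, sub_zero, Nat.cast_pow, Nat.cast_ofNat]
    by_cases h1 : Arrival (2 * i + 1) n
    · simp [h1, h1.disjoint]
    · simp [h1]

theorem optFlow_conservation {v : Fin (2 * ℓ + 3)} (h0 : v ≠ 0) (hl : v ≠ Fin.last _) (n : ℤ) :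
    ∑ e ∈ edges ℓ with e.2 = v, optFlow e (n - delay e) =
      ∑ e ∈ edges ℓ with e.1 = v, optFlow e n := by
  have h0' : v.val ≠ 0 := fun h => h0 (Fin.ext h)
  have hl' : v.val ≠ 2 * ℓ + 2 := fun h => hl (Fin.ext h)
  have hlt := v.isLt
  rcases Nat.even_or_odd' v.val with ⟨i, hi | hi⟩
  · obtain ⟨j, rfl⟩ : ∃ j, i = j + 1 := ⟨i - 1, by omega⟩
    have hv : v.val = 2 * j + 2 := by omega
    rw [filter_snd_even hv, filter_fst_even hv (by omega), Finset.sum_singleton,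
      Finset.sum_singleton]
    simp only [optFlow, hv, delay, arrival_even, if_true, Nat.cast_zero, sub_zero]
    rw [show (2 * j + 1 + 1) / 2 = (2 * j + 2 + 1) / 2 by omega]
  · rw [sum_optFlow_in_odd hi, sum_optFlow_out_odd hi]

/-- Flow on an edge leaving an inner vertex is only possible at arrival times. -/
theorem arrival_of_flow_ne_zero {g : Fin (2 * ℓ + 3) × Fin (2 * ℓ + 3) → ℤ → ℝ}
    (h0 : ∀ e ∈ edges ℓ, ∀ n, 0 ≤ g e n)
    (hs : ∀ e ∈ edges ℓ, e.1 = 0 → ∀ n, g e n ≠ 0 → n = 0)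
    (hc : ∀ v, v ≠ 0 → v ≠ Fin.last _ → ∀ n, (∃ e ∈ edges ℓ, e.1 = v ∧ g e n ≠ 0) →
      ∑ e ∈ edges ℓ with e.2 = v, g e (n - delay e) = ∑ e ∈ edges ℓ with e.1 = v, g e n)
    {e : Fin (2 * ℓ + 3) × Fin (2 * ℓ + 3)} (he : e ∈ edges ℓ) {n : ℤ} (hn : g e n ≠ 0) :
    Arrival e.1 n := by
  suffices H : ∀ j, ∀ e ∈ edges ℓ, e.1.val = j → ∀ n, g e n ≠ 0 → Arrival e.1 n from
    H _ e he rfl n hn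
  intro j
  induction j using Nat.strong_induction_on with
  | _ j ih =>
    intro e he hj n hn
    by_cases hz : e.1 = 0
    · rw [hz]; exact (arrival_zero n).2 (hs e he hz n hn)
    have hl : e.1 ≠ Fin.last _ := by
      intro h
      have := fst_lt_snd he
      have := e.2.isLt
      rw [h, Fin.val_last] at *
      omega
    have hout : 0 < ∑ e' ∈ edges ℓ with e'.1 = e.1, g e' n :=
      Finset.sum_pos' (fun e' h' => h0 e' (Finset.mem_filter.1 h').1 n)
        ⟨e, Finset.mem_filter.2 ⟨he, rfl⟩, lt_of_le_of_ne (h0 e he n) hn.symm⟩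
    -- Positive outflow forces positive inflow. Conservation is needed only at steps where flow
    -- leaves, and these lie in the considered interval.
    rw [← hc e.1 hz hl n ⟨e, he, rfl, hn⟩] at hout
    obtain ⟨e', h', hne⟩ := Finset.exists_ne_zero_of_sum_ne_zero hout.ne'
    obtain ⟨h1, h2⟩ := Finset.mem_filter.1 h'
    have := (ih e'.1.val (by rw [← hj, ← h2]; exact fst_lt_snd h1) e' h1 rfl _ hne).step h1
    rw [h2] at this
    simpa using this

/-! ### The minimum cut -/

/-- The minimum cut: a vertex is on the source side at its arrival times. -/
def optCut (v : Fin (2 * ℓ + 3)) (n : ℤ) : Bool :=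
  if v = 0 then true else if v = Fin.last _ then false else decide (Arrival v n)

/-- The contribution of the time step `n` to the capacity of the cut `S`. -/
def cutStep (S : Fin (2 * ℓ + 3) → ℤ → Bool) (n : ℤ) : ℝ :=
  ∑ e ∈ edges ℓ with S e.1 n = true ∧ ¬ S e.2 (n + delay e) = true, (stepCap e n : ℝ)

theorem le_cutStep {S : Fin (2 * ℓ + 3) → ℤ → Bool} {n : ℤ}
    {e : Fin (2 * ℓ + 3) × Fin (2 * ℓ + 3)} (he : e ∈ edges ℓ) (h1 : S e.1 n = true)
    (h2 : ¬ S e.2 (n + delay e) = true) : (stepCap e n : ℝ) ≤ cutStep S n :=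
  Finset.single_le_sum (f := fun e => (stepCap e n : ℝ)) (fun _ _ => Nat.cast_nonneg _)
    (Finset.mem_filter.2 ⟨he, h1, h2⟩)

theorem cutStep_nonneg (S : Fin (2 * ℓ + 3) → ℤ → Bool) (n : ℤ) : 0 ≤ cutStep S n :=
  Finset.sum_nonneg fun _ _ => Nat.cast_nonneg _

/-- Half of the steps in the window are even; this is the optimal value. -/
theorem sum_arrival_last :
    ∑ k ∈ Finset.range (2 ^ (ℓ + 1)), (if Arrival (2 * ℓ + 1) (k : ℤ) then (1 : ℝ) else 0) =
      2 ^ ℓ := by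
  have h : ∀ m : ℕ, ∑ k ∈ Finset.range (2 * m), (if (k : ℤ) % 2 = 0 then (1 : ℝ) else 0) = m := by
    intro m
    induction m with
    | zero => simp
    | succ m ih =>
      rw [show 2 * (m + 1) = 2 * m + 1 + 1 by ring, Finset.sum_range_succ, Finset.sum_range_succ,
        ih, if_pos (by omega), if_neg (by omega)]
      push_cast
      ring
  have h2 := h (2 ^ ℓ)
  rw [← pow_succ'] at h2
  push_cast at h2
  rw [← h2]
  refine Finset.sum_congr rfl fun k hk => ?_
  have hk' := Finset.mem_range.1 hk
  simp only [arrival_last (ℓ := ℓ) (n := (k : ℤ)) (by omega) (by exact_mod_cast hk')]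

/-- The heart of the lower bound for cuts: either an edge of high capacity is cut, or all arrivals
at the last inner vertex are on the source side. -/
theorem sum_cutStep {S : Fin (2 * ℓ + 3) → ℤ → Bool}
    (hs : ∀ n : ℤ, 0 ≤ n → n < 2 ^ (ℓ + 1) → S 0 n = true)
    (ht : ∀ n : ℤ, 0 ≤ n → n < 2 ^ (ℓ + 1) → S (Fin.last _) n = false) :
    2 ^ ℓ ≤ ∑ k ∈ Finset.range (2 ^ (ℓ + 1)), cutStep S k ∧
    (∑ k ∈ Finset.range (2 ^ (ℓ + 1)), cutStep S k ≤ 2 ^ ℓ →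
      ∀ k : ℕ, k < 2 ^ (ℓ + 1) → S (lastEdge ℓ).1 k = decide (Arrival (2 * ℓ + 1) k)) := by
  -- One such edge already costs more than the optimum. The `+ 1` makes this strict, so the equality
  -- case excludes it as well.
  by_cases hbig : ∃ k : ℕ, k < 2 ^ (ℓ + 1) ∧ ∃ e ∈ edges ℓ, stepCap e k = 2 ^ ℓ + 1 ∧
      S e.1 k = true ∧ ¬ S e.2 (k + delay e) = true
  · obtain ⟨k, hk, e, he, hcap, h1, h2⟩ := hbig
    have : (2 : ℝ) ^ ℓ + 1 ≤ ∑ k ∈ Finset.range (2 ^ (ℓ + 1)), cutStep S k := by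
      calc (2 : ℝ) ^ ℓ + 1 = (stepCap e (k : ℤ) : ℝ) := by rw [hcap]; push_cast; rfl
        _ ≤ cutStep S k := le_cutStep he h1 h2
        _ ≤ _ := Finset.single_le_sum (f := fun k : ℕ => cutStep S (k : ℤ))
            (fun _ _ => cutStep_nonneg _ _) (Finset.mem_range.2 hk)
    exact ⟨by linarith, fun h => by linarith⟩
  push Not at hbig
  -- With no expensive edge cut, source-side membership passes from a predecessor to each arrival.
  have harr : ∀ j, ∀ v : Fin (2 * ℓ + 3), v.val = j → v ≠ Fin.last _ → ∀ n, Arrival v n →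
      S v n = true := by
    intro j
    induction j using Nat.strong_induction_on with
    | _ j ih =>
      intro v hj hvl n hn
      by_cases hz : v = 0
      · rw [hz]; exact hs n hn.nonneg (hn.lt v.isLt)
      obtain ⟨e, he, rfl, h1⟩ := hn.exists_pred (fun h => hz (Fin.ext h))
      have hlt := fst_lt_snd he
      have hne : e.2.val ≠ 2 * ℓ + 2 := fun h => hvl (Fin.ext h)
      obtain ⟨k, hk⟩ := Int.eq_ofNat_of_zero_le h1.nonneg
      have hk2 : k < 2 ^ (ℓ + 1) := by
        have := h1.lt e.1.isLt
        rw [hk] at this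
        exact_mod_cast this
      have h3 := ih e.1.val (hj ▸ hlt) e.1 rfl (by
        intro h; rw [h, Fin.val_last] at hlt; have := e.2.isLt; omega) _ h1
      rw [hk] at h3
      -- An edge traversed by an arrival is expensive: the source edge is used at step `0` only, and
      -- the last edge is excluded by `hne`.
      have := hbig k hk2 e he (by
        unfold stepCap
        split_ifs with ha hb
        · rfl
        · rw [ha, arrival_zero, hk] at h1; exact absurd h1 hb
        · rfl) h3
      rwa [show (k : ℤ) + delay e = n by omega] at this
  have hge : ∀ k : ℕ, k < 2 ^ (ℓ + 1) →
      (if S (lastEdge ℓ).1 k = true then (1 : ℝ) else 0) ≤ cutStep S k := by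
    intro k hk
    split_ifs with h
    · have h2 := ht k (by omega) (by exact_mod_cast hk)
      have := le_cutStep (S := S) (n := k) lastEdge_mem h (by
        rw [delay_lastEdge, show (lastEdge ℓ).2 = Fin.last _ from rfl]
        simp [h2])
      simpa [stepCap_lastEdge] using this
    · exact cutStep_nonneg _ _
  have hge2 : ∀ k : ℕ, (if Arrival (2 * ℓ + 1) (k : ℤ) then (1 : ℝ) else 0) ≤
      (if S (lastEdge ℓ).1 k = true then (1 : ℝ) else 0) := by
    intro k
    by_cases h : Arrival (2 * ℓ + 1) (k : ℤ)
    · rw [if_pos h, if_pos (harr _ (lastEdge ℓ).1 rfl (by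
        simp [lastEdge, Fin.ext_iff]) _ h)]
    · rw [if_neg h]; split_ifs <;> norm_num
  have hge3 : ∀ k ∈ Finset.range (2 ^ (ℓ + 1)),
      (if Arrival (2 * ℓ + 1) (k : ℤ) then (1 : ℝ) else 0) ≤ cutStep S k :=
    fun k hk => (hge2 k).trans (hge k (Finset.mem_range.1 hk))
  have hsum := Finset.sum_le_sum hge3
  refine ⟨by rwa [sum_arrival_last] at hsum, fun hle k hk => ?_⟩
  -- Equal totals force termwise equality, and the indicator of the source side is squeezed in
  -- between.
  have heq := (Finset.sum_eq_sum_iff_of_le hge3).1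
    (le_antisymm hsum (by rw [sum_arrival_last]; exact hle)) k (Finset.mem_range.2 hk)
  have h1 := hge k hk
  have h2 := hge2 k
  rw [← heq] at h1
  have h3 := le_antisymm h2 h1
  by_cases ha : Arrival (2 * ℓ + 1) (k : ℤ) <;> by_cases hb : S (lastEdge ℓ).1 k = true <;>
    simp [ha, hb] at h3 ⊢

/-- Only the last edge contributes to the capacity of the optimal cut. -/
theorem cutStep_optCut (n : ℤ) :
    cutStep (optCut (ℓ := ℓ)) n = if Arrival (2 * ℓ + 1) n then 1 else 0 := by
  unfold cutStep
  rw [Finset.sum_filter, Finset.sum_eq_single (lastEdge ℓ)]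
  · have h1 : (lastEdge ℓ).1 ≠ 0 := by simp [lastEdge, Fin.ext_iff]
    have h2 : (lastEdge ℓ).1 ≠ Fin.last _ := by simp [lastEdge, Fin.ext_iff]
    have h3 : (lastEdge ℓ).2 ≠ 0 := by simp [lastEdge, Fin.ext_iff]
    have h4 : (lastEdge ℓ).2 = Fin.last _ := rfl
    simp only [optCut, h1, h2, h4, if_false, if_true, stepCap_lastEdge]
    by_cases h : Arrival (2 * ℓ + 1) n <;> simp [lastEdge, h]
  · intro e he hne
    have h2l : e.2 ≠ Fin.last _ := fun h => hne (eq_lastEdge he (by rw [h]; rfl))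
    have hlt := fst_lt_snd he
    have h20 : e.2 ≠ 0 := fun h => by rw [h] at hlt; simp at hlt
    have h1l : e.1 ≠ Fin.last _ := by
      intro h; rw [h, Fin.val_last] at hlt; have := e.2.isLt; omega
    rw [ite_eq_right_iff]
    rintro ⟨h1, h2⟩
    simp only [optCut, h2l, h20, h1l, if_false, decide_eq_true_eq] at h1 h2
    -- The source never changes sides, but its edge has capacity at step `0` only, when its head is
    -- an arrival too.
    by_cases hz : e.1 = 0
    · unfold stepCap
      rw [if_pos (by rw [hz]; rfl), if_neg, Nat.cast_zero]
      rintro rfl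
      exact h2 (Arrival.step he (by rw [hz]; exact (arrival_zero 0).2 rfl))
    · rw [if_neg hz, decide_eq_true_eq] at h1
      exact absurd (h1.step he) h2
  · exact fun h => absurd lastEdge_mem h

end BinaryDelay

/-! ### Step functions on the time grid -/

theorem eventually_floor_eq_right (x : ℝ) : ∀ᶠ y in 𝓝[>] x, ⌊y⌋ = ⌊x⌋ := by
  filter_upwards [Ioo_mem_nhdsGT (Int.lt_floor_add_one x)] with y hy
  exact Int.floor_eq_iff.2 ⟨(Int.floor_le x).trans hy.1.le, hy.2⟩

theorem isPiecewiseConstant_comp_floor {α : Type} {F : ℤ → α} {c : α} {m : ℤ}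
    (hF : ∀ n, ¬ (0 ≤ n ∧ n < m) → F n = c) : IsPiecewiseConstant fun θ : ℝ => F ⌊θ⌋ := by
  refine ⟨⟨(Finset.Icc 0 m).image (fun n : ℤ => (n : ℝ)), fun x y hxy hP => ?_⟩, fun x => Or.inr ?_⟩
  · have h : ∀ n : ℤ, ¬ (0 ≤ n ∧ n ≤ m ∧ ⌊x⌋ < n ∧ n ≤ ⌊y⌋) := by
      rintro n ⟨h0, hm, hx, hy⟩
      exact hP n (Finset.mem_image.2 ⟨n, Finset.mem_Icc.2 ⟨h0, hm⟩, rfl⟩)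
        ⟨(Int.floor_lt.1 hx).le, Int.le_floor.1 hy⟩
    have hle := Int.floor_le_floor hxy
    rcases eq_or_lt_of_le hle with he | hlt
    · simp only [he]
    · have h1 := h (⌊x⌋ + 1)
      have h2 := h ⌊y⌋
      have h3 := h 0
      have h4 := h m
      show F ⌊x⌋ = F ⌊y⌋
      rw [hF ⌊x⌋ (by omega), hF ⌊y⌋ (by omega)]
  · filter_upwards [eventually_floor_eq_right x] with y hy
    rw [hy]

theorem changeTimes_const {α : Type} (c : α) : changeTimes (fun _ => c) = ∅ := by
  refine Set.eq_empty_of_forall_notMem fun θ h => ?_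
  obtain ⟨_, h⟩ := Eventually.exists (show ∀ᶠ _ in 𝓝[>] (0 : ℝ), c ≠ c from h)
  exact h rfl

theorem changeTimes_first_step {α : Type} {b c : α} (h : b ≠ c) :
    changeTimes (fun θ : ℝ => if ⌊θ⌋ = 0 then b else c) = {0, 1} := by
  have hfl : ∀ θ : ℝ, ⌊θ⌋ = 0 ↔ 0 ≤ θ ∧ θ < 1 := fun θ => by
    rw [Int.floor_eq_iff]; norm_num
  ext θ
  simp only [changeTimes, hfl, Set.mem_ofPred_eq, Set.mem_insert_iff, Set.mem_singleton_iff]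
  constructor
  · intro hθ
    by_contra! hne
    obtain ⟨δ, hδ, hd⟩ : ∃ δ > 0, ∀ ε ∈ Set.Ioo (0 : ℝ) δ,
        (0 ≤ θ - ε ∧ θ - ε < 1 ↔ 0 ≤ θ + ε ∧ θ + ε < 1) := by
      rcases lt_or_gt_of_ne hne.1 with h0 | h0
      · refine ⟨-θ, by linarith, fun ε hε => ?_⟩
        constructor <;> intro H <;> linarith [hε.1, hε.2, H.1, H.2]
      rcases lt_or_gt_of_ne hne.2 with h1 | h1
      · refine ⟨min θ (1 - θ), lt_min h0 (by linarith), fun ε hε => ?_⟩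
        have := lt_min_iff.1 hε.2
        constructor <;> intro H <;> constructor <;> linarith [hε.1, this.1, this.2, H.1, H.2]
      · refine ⟨θ - 1, by linarith, fun ε hε => ?_⟩
        constructor <;> intro H <;> linarith [hε.1, hε.2, H.1, H.2]
    obtain ⟨ε, h1, h2⟩ := (hθ.and (Ioo_mem_nhdsGT hδ)).exists
    exact h1 (by simp only [hd ε h2])
  · intro hθ
    filter_upwards [Ioo_mem_nhdsGT (zero_lt_one (α := ℝ))] with ε hε
    rcases hθ with rfl | rfl
    · rw [if_neg (fun H => by linarith [hε.1, H.1]),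
        if_pos ⟨by linarith [hε.1], by linarith [hε.2]⟩]
      exact h.symm
    · rw [if_pos ⟨by linarith [hε.2], by linarith [hε.1]⟩,
        if_neg (fun H => by linarith [hε.1, H.2])]
      exact h

theorem two_pow_le_encard {X : Type} {ℓ : ℕ} {ι : ℕ → X} (hι : Function.Injective ι) {T : Set X}
    (h : ∀ k, 0 < k → k < 2 ^ (ℓ + 1) → ι k ∈ T) : 2 ^ ℓ ≤ T.encard := by
  -- The `2^(ℓ+1) - 1` available points are more than needed; the first `2^ℓ` suffice.
  have hs : ((Finset.Ico 1 (2 ^ ℓ + 1)).map ⟨ι, hι⟩ : Set X) ⊆ T := by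
    intro x hx
    simp only [Finset.coe_map, Set.mem_image, Finset.coe_Ico, Set.mem_Ico] at hx
    obtain ⟨k, hk, rfl⟩ := hx
    have := Nat.one_le_two_pow (n := ℓ)
    exact h k (by omega) (by rw [pow_succ]; omega)
  have := Set.encard_le_encard hs
  rw [Set.encard_coe_eq_coe_finsetCard] at this
  simpa using this

theorem sum_range_le_sum_Icc {h : ℤ → ℝ} (h0 : ∀ n, 0 ≤ h n) {A B : ℤ} {K : ℕ} (hA : A ≤ 0)
    (hB : (K : ℤ) ≤ B) : ∑ k ∈ Finset.range K, h k ≤ ∑ n ∈ Finset.Icc A B, h n := by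
  rw [show ∑ k ∈ Finset.range K, h k = ∑ n ∈ (Finset.range K).map Nat.castEmbedding, h n by
    rw [Finset.sum_map]; rfl]
  refine Finset.sum_le_sum_of_subset_of_nonneg (fun n hn => ?_) fun n _ _ => h0 n
  obtain ⟨k, hk, rfl⟩ := Finset.mem_map.1 hn
  have := Finset.mem_range.1 hk
  simp only [Nat.castEmbedding_apply, Finset.mem_Icc]
  omega

theorem sum_Icc_eq_sum_range {h : ℤ → ℝ} {A B : ℤ} {K : ℕ} (hA : A ≤ 0) (hB : (K : ℤ) ≤ B)
    (h0 : ∀ n, h n ≠ 0 → 0 ≤ n ∧ n < K) :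
    ∑ n ∈ Finset.Icc A B, h n = ∑ k ∈ Finset.range K, h k := by
  rw [show ∑ k ∈ Finset.range K, h k = ∑ n ∈ (Finset.range K).map Nat.castEmbedding, h n by
    rw [Finset.sum_map]; rfl]
  symm
  refine Finset.sum_subset (fun n hn => ?_) fun n _ hn => ?_
  · obtain ⟨k, hk, rfl⟩ := Finset.mem_map.1 hn
    have := Finset.mem_range.1 hk
    simp only [Nat.castEmbedding_apply, Finset.mem_Icc]
    omega
  · by_contra hne
    obtain ⟨h1, h2⟩ := h0 n hne
    refine hn (Finset.mem_map.2 ⟨n.toNat, Finset.mem_range.2 (by omega), ?_⟩)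
    simp only [Nat.castEmbedding_apply]
    omega

/-- Differences of consecutive partial sums: vanishing excess becomes conservation in every single
step. -/
theorem eq_zero_of_sum_Icc_eq_zero {F : ℤ → ℝ} {A B : ℤ}
    (h : ∀ n ∈ Set.Icc A B, ∑ ζ ∈ Finset.Icc A n, F ζ = 0) {n : ℤ} (hn : n ∈ Set.Icc A B) :
    F n = 0 := by
  have h1 := h n hn
  have hI : Finset.Icc A n = insert n (Finset.Icc A (n - 1)) := by
    have := hn.1
    ext k
    simp only [Finset.mem_Icc, Finset.mem_insert]
    omega
  rw [hI, Finset.sum_insert (by simp)] at h1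
  rcases eq_or_lt_of_le hn.1 with rfl | hlt
  · simpa using h1
  · rw [h (n - 1) ⟨by omega, by have := hn.2; omega⟩, add_zero] at h1
    exact h1

/-! ### The network and its size. -/

namespace BinaryDelay

open DynamicNetwork

variable {ℓ : ℕ}

theorem stepCap_isPiecewiseConstant (e : Fin (2 * ℓ + 3) × Fin (2 * ℓ + 3)) :
    IsPiecewiseConstant fun θ : ℝ => (stepCap e ⌊θ⌋ : ℝ) := by
  by_cases h0 : e.1.val = 0
  · refine isPiecewiseConstant_comp_floor (F := fun n => (stepCap e n : ℝ)) (c := 0) (m := 1)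
      fun n hn => ?_
    simp [stepCap, h0, show n ≠ 0 by omega]
  · refine isPiecewiseConstant_comp_floor (F := fun n => (stepCap e n : ℝ))
      (c := (stepCap e 0 : ℝ)) (m := 0) fun n _ => ?_
    simp [stepCap, h0]

/-- The network: a delay line of `ℓ` pairs of a fast and a slow route, so that `2 ^ ℓ` units of
flow can enter during the time step `0` only and have to leave one at a time. -/
def network (ℓ : ℕ) : DynamicNetwork (Fin (2 * ℓ + 3)) where
  source := 0
  target := Fin.last (2 * ℓ + 2)
  source_ne_target := (Fin.last_pos (n := 2 * ℓ + 1)).ne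
  edges := edges ℓ
  transit e := delay e
  transit_nonneg _ _ := Nat.cast_nonneg _
  cap e θ := stepCap e ⌊θ⌋
  cap_nonneg _ _ _ := Nat.cast_nonneg _
  cap_piecewiseConstant e _ := stepCap_isPiecewiseConstant e

@[simp] theorem network_edges : (network ℓ).edges = edges ℓ := rfl
@[simp] theorem network_source : (network ℓ).source = 0 := rfl
@[simp] theorem network_target : (network ℓ).target = Fin.last (2 * ℓ + 2) := rfl
@[simp] theorem network_transit (e : Fin (2 * ℓ + 3) × Fin (2 * ℓ + 3)) :
    (network ℓ).transit e = delay e := rfl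
@[simp] theorem network_cap (e : Fin (2 * ℓ + 3) × Fin (2 * ℓ + 3)) (θ : ℝ) :
    (network ℓ).cap e θ = stepCap e ⌊θ⌋ := rfl
@[simp] theorem network_transitSteps (e : Fin (2 * ℓ + 3) × Fin (2 * ℓ + 3)) :
    (network ℓ).transitSteps e = delay e := by
  simp [transitSteps]

theorem network_isAcyclic : (network ℓ).IsAcyclic := by
  intro v hv
  have : ∀ w, Relation.TransGen (fun x y => (x, y) ∈ (network ℓ).edges) v w → v < w := by
    intro w hw
    induction hw with
    | single h => exact fst_lt_snd h
    | tail _ h ih => exact ih.trans (fst_lt_snd h)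
  exact lt_irrefl v (this v hv)

theorem changeTimes_cap (e : Fin (2 * ℓ + 3) × Fin (2 * ℓ + 3)) :
    changeTimes ((network ℓ).cap e) = if e.1.val = 0 then {0, 1} else ∅ := by
  show changeTimes (fun θ : ℝ => (stepCap e ⌊θ⌋ : ℝ)) = _
  split_ifs with h
  · have : (fun θ : ℝ => (stepCap e ⌊θ⌋ : ℝ)) =
        fun θ : ℝ => if ⌊θ⌋ = 0 then ((2 ^ ℓ + 1 : ℕ) : ℝ) else 0 := by
      funext θ
      simp only [stepCap, h, if_true]
      split_ifs <;> simp
    rw [this]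
    exact changeTimes_first_step (by positivity)
  · simp only [stepCap, h, if_false]
    exact changeTimes_const _

theorem network_numCapacityChanges : (network ℓ).numCapacityChanges = 2 := by
  unfold numCapacityChanges
  rw [network_edges, Finset.sum_eq_single
    ((⟨0, by omega⟩, ⟨1, by omega⟩) : Fin (2 * ℓ + 3) × Fin (2 * ℓ + 3))]
  · rw [changeTimes_cap, if_pos rfl]
    exact Set.encard_pair (by norm_num)
  · rintro e he hne
    rw [changeTimes_cap, if_neg, Set.encard_empty]
    intro h0
    rw [mem_edges] at he
    exact hne (Prod.ext (Fin.ext h0) (Fin.ext (by simp only; omega)))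
  · intro h
    exact absurd (by simp [mem_edges]) h

theorem network_isDiscrete : (network ℓ).IsDiscrete :=
  ⟨fun e _ => ⟨delay e, by simp⟩, fun e _ θ => by simp⟩

theorem network_hasSizeAtMost : (network ℓ).HasSizeAtMost (2 * ℓ + 3) := by
  have h2 : 2 ^ ℓ * 2 ^ 3 ≤ 2 ^ (2 * ℓ + 3) := by
    rw [← pow_add]; exact Nat.pow_le_pow_right (by norm_num) (by omega)
  have h3 : 1 ≤ 2 ^ ℓ := Nat.one_le_two_pow
  refine ⟨by simp, fun e he => ⟨⟨delay e, by simp, ?_⟩, fun θ => ⟨stepCap e ⌊θ⌋, by simp, ?_⟩,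
    fun θ hθ => ?_⟩⟩
  · have := delay_le he
    exact Nat.size_le.2 (by omega)
  · refine Nat.size_le.2 ?_
    unfold stepCap
    split_ifs <;> omega
  · rw [changeTimes_cap] at hθ
    split_ifs at hθ
    · rcases hθ with rfl | rfl
      · exact ⟨0, by simp, by simp⟩
      · exact ⟨1, by simp, by simp⟩
    · exact absurd hθ (Set.notMem_empty _)

/-! ### Cuts in discrete time -/

/-- The convention that after time `B` every vertex is on the source side. -/
def extendCut {V T : Type} [LT T] [DecidableLT T] (B : T) (S : V → T → Bool) (v : V) (θ : T) :
    Bool :=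
  decide (θ > B) || S v θ

theorem dCutCapacity_eq (A B : ℤ) (S : Fin (2 * ℓ + 3) → ℤ → Bool) :
    (network ℓ).dCutCapacity A B S = ∑ n ∈ Finset.Icc A B, cutStep (extendCut B S) n := by
  simp [dCutCapacity, cutStep, extendCut]

theorem optCut_source (n : ℤ) : optCut (ℓ := ℓ) 0 n = true := by simp [optCut]

theorem optCut_target (n : ℤ) : optCut (ℓ := ℓ) (Fin.last _) n = false := by
  simp [optCut, Fin.ext_iff]

/-- Enlarging the source side at other times than `n` can only put heads of cut edges on it. This
absorbs the convention about times after `B`. -/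
theorem cutStep_extend_le {S T : Fin (2 * ℓ + 3) → ℤ → Bool} {n : ℤ}
    (h1 : ∀ v, T v n = true → S v n = true)
    (h2 : ∀ v, ∀ m, S v m = true → T v m = true) : cutStep T n ≤ cutStep S n := by
  refine Finset.sum_le_sum_of_subset_of_nonneg (fun e he => ?_) fun _ _ _ => Nat.cast_nonneg _
  simp only [Finset.mem_filter] at he ⊢
  exact ⟨he.1, h1 _ he.2.1, fun h => he.2.2 (h2 _ _ h)⟩

theorem dCutCapacity_optCut_le {A B : ℤ} (hA : A ≤ 0) (hB : 2 ^ (ℓ + 1) ≤ B) :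
    (network ℓ).dCutCapacity A B optCut ≤ 2 ^ ℓ := by
  rw [dCutCapacity_eq, ← sum_arrival_last]
  rw [← sum_Icc_eq_sum_range (h := fun n => if Arrival (2 * ℓ + 1) n then (1 : ℝ) else 0) hA
    (B := B) (by exact_mod_cast hB)]
  · refine Finset.sum_le_sum fun n hn => ?_
    rw [← cutStep_optCut]
    have := (Finset.mem_Icc.1 hn).2
    refine cutStep_extend_le (fun v h => ?_) fun v m h => ?_
    · simpa [extendCut, this.not_gt] using h
    · simp [extendCut, h]
  · intro n hn
    have h : Arrival (2 * ℓ + 1) n := by by_contra h; simp [h] at hn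
    exact ⟨h.nonneg, by exact_mod_cast h.lt (ℓ := ℓ) (by omega)⟩

/-- Steps outside the window contribute nonnegative amounts, so both the bound and its equality case
carry over from `sum_cutStep`. -/
theorem dCutCapacity_ge {A B : ℤ} (hA : A ≤ 0) (hB : 2 ^ (ℓ + 1) ≤ B)
    {R : Fin (2 * ℓ + 3) → ℤ → Bool} (hR : (network ℓ).IsDCut A B R) :
    2 ^ ℓ ≤ (network ℓ).dCutCapacity A B R ∧ ((network ℓ).dCutCapacity A B R ≤ 2 ^ ℓ →
      ∀ k : ℕ, k < 2 ^ (ℓ + 1) → R (lastEdge ℓ).1 k = decide (Arrival (2 * ℓ + 1) k)) := by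
  obtain ⟨h1, h2⟩ := sum_cutStep (S := extendCut B R)
    (fun n h0 h => by simp [extendCut]; exact .inr (hR.source_mem n ⟨by omega, by omega⟩))
    (fun n h0 h => by
      simp [extendCut]; exact ⟨by omega, hR.target_notMem n ⟨by omega, by omega⟩⟩)
  have h3 := sum_range_le_sum_Icc (cutStep_nonneg (extendCut B R)) hA (K := 2 ^ (ℓ + 1)) (B := B)
    (by exact_mod_cast hB)
  rw [dCutCapacity_eq]
  refine ⟨h1.trans h3, fun h4 k hk => ?_⟩
  rw [← h2 (h3.trans h4) k hk]
  have : (k : ℤ) < 2 ^ (ℓ + 1) := by exact_mod_cast hk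
  simp [extendCut, show ¬ (B < (k : ℤ)) by omega]

theorem optCut_isMinDCut {A B : ℤ} (hA : A ≤ 0) (hB : 2 ^ (ℓ + 1) ≤ B) :
    (network ℓ).IsMinDCut A B optCut :=
  ⟨⟨fun n _ => optCut_source n, fun n _ => optCut_target n⟩, fun _ hR =>
    (dCutCapacity_optCut_le hA hB).trans (dCutCapacity_ge hA hB hR).1⟩

theorem optCut_constantOutside (v : Fin (2 * ℓ + 3)) :
    ∃ c, ∀ n : ℤ, ¬ (0 ≤ n ∧ n < 2 ^ (ℓ + 1)) → optCut v n = c := by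
  by_cases h0 : v = 0
  · exact ⟨true, fun n _ => by rw [h0, optCut_source]⟩
  · refine ⟨false, fun n hn => ?_⟩
    have : ¬ Arrival v n := fun h => hn ⟨h.nonneg, h.lt v.isLt⟩
    simp [optCut, h0, this]

theorem exists_isMinDCutInfinite : ∃ S, (network ℓ).IsMinDCutInfinite S := by
  refine ⟨optCut, 0, 2 ^ (ℓ + 1), by positivity, fun v => ?_, fun a' b' ha hb =>
    ⟨a', b', le_rfl, le_rfl, optCut, optCut_isMinDCut ha hb, fun _ _ _ => rfl⟩⟩
  obtain ⟨c, hc⟩ := optCut_constantOutside v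
  exact ⟨fun x y hx hy => by rw [hc x (by omega), hc y (by omega)],
    fun x y hx hy => by rw [hc x (by omega), hc y (by omega)]⟩

/-- A function that alternates between two values has many changes. -/
theorem two_pow_le_encard_dChangeTimes {α : Type} {g : ℤ → α} {b c : α} (hbc : b ≠ c)
    (h : ∀ k : ℕ, k < 2 ^ (ℓ + 1) → g k = if Arrival (2 * ℓ + 1) k then b else c) :
    2 ^ ℓ ≤ (dChangeTimes g).encard := by
  refine two_pow_le_encard (ι := fun k : ℕ => (k : ℤ)) Nat.cast_injective fun k h0 hk => ?_
  obtain ⟨j, rfl⟩ : ∃ j, k = j + 1 := ⟨k - 1, by omega⟩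
  have hk' : ((j + 1 : ℕ) : ℤ) < 2 ^ (ℓ + 1) := by exact_mod_cast hk
  have h1 := h (j + 1) hk
  have h2 := h j (by omega)
  simp only [arrival_last (ℓ := ℓ) (n := ((j + 1 : ℕ) : ℤ)) (by omega) hk',
    arrival_last (ℓ := ℓ) (n := (j : ℤ)) (by omega) (by omega)] at h1 h2
  show g (((j + 1 : ℕ) : ℤ) - 1) ≠ g ((j + 1 : ℕ) : ℤ)
  rw [h1, show ((j + 1 : ℕ) : ℤ) - 1 = j by omega, h2]
  rcases Int.emod_two_eq_zero_or_one (j : ℤ) with hj | hj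
  · rw [if_pos hj, if_neg (by omega)]; exact hbc
  · rw [if_neg (by omega), if_pos (by omega)]; exact hbc.symm

theorem two_pow_le_dCutComplexity {S : Fin (2 * ℓ + 3) → ℤ → Bool}
    (hS : (network ℓ).IsMinDCutInfinite S) : 2 ^ ℓ ≤ dCutComplexity S := by
  obtain ⟨a, b, hab, -, h⟩ := hS
  -- The interval is enlarged to contain the window on which all minimum cuts agree at the last
  -- inner vertex.
  obtain ⟨A, B, hA, hB, R, hR, hRS⟩ := h (min a 0) (max b (2 ^ (ℓ + 1))) (min_le_left _ _)
    (le_max_left _ _)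
  have hA' : A ≤ 0 := hA.trans (min_le_right _ _)
  have hB' : 2 ^ (ℓ + 1) ≤ B := (le_max_right _ _).trans hB
  have hval := (dCutCapacity_ge hA' hB' hR.1).2 ((hR.2 _ (optCut_isMinDCut hA' hB').1).trans
    (dCutCapacity_optCut_le hA' hB'))
  refine (two_pow_le_encard_dChangeTimes (g := S (lastEdge ℓ).1) (b := true) (c := false) (by simp)
    fun k hk => ?_).trans (Finset.single_le_sum (f := fun v => (dChangeTimes (S v)).encard)
      (fun _ _ => zero_le) (Finset.mem_univ _))
  have hk' : (k : ℤ) < 2 ^ (ℓ + 1) := by exact_mod_cast hk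
  rw [← hRS _ _ ⟨(min_le_right _ _).trans (by omega), hk'.le.trans (le_max_right _ _)⟩, hval k hk]
  split_ifs with h <;> simp [h]

/-! ### Flows in discrete time -/

/-- Flow enters edges before `2^(ℓ+1)` and is delayed by at most `2^ℓ`, so `2^(ℓ+2)` leaves time for
every edge to clear. -/
theorem optFlow_isDFlow {A B : ℤ} (hA : A ≤ 0) (hB : 2 ^ (ℓ + 2) ≤ B) :
    (network ℓ).IsDFlow A B optFlow where
  zero_outside e he n hn := by
    by_contra h
    obtain ⟨h1, h2⟩ := optFlow_ne_zero h
    have h3 := delay_le he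
    zify at h3
    rw [network_transitSteps] at hn
    rw [pow_succ, pow_succ] at hB
    rw [pow_succ] at h2
    exact hn ⟨by omega, by omega⟩
  nonneg e _ n := optFlow_nonneg e n
  le_cap e he n _ := by simpa using optFlow_le_cap he n
  conservation v h0 hl n _ := by
    unfold dExcess
    refine Finset.sum_eq_zero fun n _ => ?_
    simp only [network_transitSteps, network_edges]
    rw [optFlow_conservation h0 hl, sub_self]

theorem dExcess_target (A B : ℤ) (f : Fin (2 * ℓ + 3) × Fin (2 * ℓ + 3) → ℤ → ℝ) :
    (network ℓ).dExcess A f (network ℓ).target B = ∑ n ∈ Finset.Icc A B, f (lastEdge ℓ) n := by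
  show ∑ n ∈ Finset.Icc A B, (∑ e ∈ edges ℓ with e.2 = Fin.last (2 * ℓ + 2),
    f e (n - (network ℓ).transitSteps e) - ∑ e ∈ edges ℓ with e.1 = Fin.last _, f e n) = _
  rw [filter_snd_target, filter_fst_target]
  simp

/-- Pointwise domination, rather than a bound on the value alone, also makes the maximum flow unique
on the last edge. -/
theorem IsDFlow_last_le {A B : ℤ} {g : Fin (2 * ℓ + 3) × Fin (2 * ℓ + 3) → ℤ → ℝ}
    (hg : (network ℓ).IsDFlow A B g) (n : ℤ) : g (lastEdge ℓ) n ≤ optFlow (lastEdge ℓ) n := by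
  by_cases h : g (lastEdge ℓ) n = 0
  · rw [h]; exact optFlow_nonneg _ _
  have hin : ∀ e ∈ edges ℓ, ∀ n, g e n ≠ 0 → n ∈ Set.Icc A (B - (network ℓ).transitSteps e) :=
    fun e he n hn => by_contra fun h => hn (hg.zero_outside e he n h)
  have harr := arrival_of_flow_ne_zero (g := g) hg.nonneg (fun e he h0 n hn => by
      by_contra hne
      have h1 := hg.le_cap e he n (hin e he n hn)
      simp only [network_cap, stepCap, h0, Fin.val_zero, if_true, Int.floor_intCast, hne,
        if_false, Nat.cast_zero] at h1
      exact hn (le_antisymm h1 (hg.nonneg e he n))) (fun v h0 hl n ⟨e, he, _, hn⟩ => by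
      have h1 := hin e he n hn
      have h2 : n ∈ Set.Icc A B := ⟨h1.1, h1.2.trans (by simp)⟩
      have := eq_zero_of_sum_Icc_eq_zero (hg.conservation v h0 hl) h2
      simpa [sub_eq_zero] using this) lastEdge_mem h
  rw [optFlow_lastEdge, if_pos (by simpa [lastEdge] using harr)]
  simpa [stepCap_lastEdge] using hg.le_cap _ lastEdge_mem n (hin _ lastEdge_mem n h)

theorem optFlow_isMaxDFlow {A B : ℤ} (hA : A ≤ 0) (hB : 2 ^ (ℓ + 2) ≤ B) :
    (network ℓ).IsMaxDFlow A B optFlow := by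
  refine ⟨optFlow_isDFlow hA hB, fun g hg => ?_⟩
  rw [dExcess_target, dExcess_target]
  exact Finset.sum_le_sum fun n _ => IsDFlow_last_le hg n

theorem exists_isMaxDFlowInfinite : ∃ f, (network ℓ).IsMaxDFlowInfinite f := by
  refine ⟨optFlow, 0, 2 ^ (ℓ + 2), by positivity, fun e _ => ?_, fun a' b' ha hb =>
    ⟨a', b', le_rfl, le_rfl, optFlow, optFlow_isMaxDFlow ha hb, fun _ _ _ _ => rfl⟩⟩
  have h0 : ∀ n, ¬ (0 ≤ n ∧ n < 2 ^ (ℓ + 1)) → optFlow e n = 0 := fun n hn =>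
    by_contra fun h => hn (optFlow_ne_zero h)
  have hp : (2 : ℤ) ^ (ℓ + 1) ≤ 2 ^ (ℓ + 2) := pow_le_pow_right₀ (by norm_num) (by omega)
  exact ⟨fun x y hx hy => by rw [h0 x (by omega), h0 y (by omega)],
    fun x y hx hy => by rw [h0 x (by omega), h0 y (by omega)]⟩

theorem two_pow_le_dFlowComplexity {f : Fin (2 * ℓ + 3) × Fin (2 * ℓ + 3) → ℤ → ℝ}
    (hf : (network ℓ).IsMaxDFlowInfinite f) : 2 ^ ℓ ≤ (network ℓ).dFlowComplexity f := by
  obtain ⟨a, b, hab, -, h⟩ := hf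
  obtain ⟨A, B, hA, hB, g, hg, hgf⟩ := h (min a 0) (max b (2 ^ (ℓ + 2))) (min_le_left _ _)
    (le_max_left _ _)
  have hA' : A ≤ 0 := hA.trans (min_le_right _ _)
  have hB' : 2 ^ (ℓ + 2) ≤ B := (le_max_right _ _).trans hB
  have hmax := hg.2 _ (optFlow_isDFlow hA' hB')
  rw [dExcess_target, dExcess_target] at hmax
  have hval := (Finset.sum_eq_sum_iff_of_le fun n _ => IsDFlow_last_le hg.1 n).1
    (le_antisymm (Finset.sum_le_sum fun n _ => IsDFlow_last_le hg.1 n) hmax)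
  refine (two_pow_le_encard_dChangeTimes (g := f (lastEdge ℓ)) (b := 1) (c := 0) (by simp)
    fun k hk => ?_).trans (Finset.single_le_sum (f := fun e => (dChangeTimes (f e)).encard)
      (fun _ _ => zero_le) lastEdge_mem)
  have hk' : (k : ℤ) < 2 ^ (ℓ + 1) := by exact_mod_cast hk
  have hp : (2 : ℤ) ^ (ℓ + 1) ≤ 2 ^ (ℓ + 2) := pow_le_pow_right₀ (by norm_num) (by omega)
  rw [← hgf _ lastEdge_mem _ ⟨(min_le_right _ _).trans (by omega),
    (hk'.le.trans hp).trans (le_max_right _ _)⟩, hval k (Finset.mem_Icc.2 ⟨by omega, by omega⟩),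
    optFlow_lastEdge]

end BinaryDelay

/-! ### Measure-theoretic tools for passing from discrete to continuous time. -/

open MeasureTheory in
theorem intervalIntegrable_of_bounded {h : ℝ → ℝ} (hm : Measurable h) {C : ℝ}
    (hC : ∀ θ, |h θ| ≤ C) (a b : ℝ) : IntervalIntegrable h volume a b :=
  ⟨Integrable.of_bound hm.aestronglyMeasurable C (ae_of_all _ hC),
    Integrable.of_bound hm.aestronglyMeasurable C (ae_of_all _ hC)⟩

open MeasureTheory in
/-- A function all of whose integrals over initial segments vanish is zero almost everywhere. -/
theorem ae_eq_zero_of_integral_eq_zero {F : ℝ → ℝ} {A B : ℝ} (hAB : A ≤ B)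
    (hF : IntervalIntegrable F volume A B) (h : ∀ θ ∈ Set.Icc A B, ∫ ζ in A..θ, F ζ = 0) :
    ∀ᵐ θ, θ ∈ Set.Icc A B → F θ = 0 := by
  -- Lebesgue differentiation: at almost every `θ` the primitive has derivative `F θ`, yet it
  -- vanishes near every interior point.
  filter_upwards [hF.ae_hasDerivAt_integral, Measure.ae_ne volume A, Measure.ae_ne volume B]
    with θ hθ hA hB hI
  have h1 := hθ (by rwa [Set.uIcc_of_le hAB]) A Set.left_mem_uIcc
  refine h1.unique ((hasDerivAt_const θ (0 : ℝ)).congr_of_eventuallyEq ?_)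
  filter_upwards [Icc_mem_nhds (lt_of_le_of_ne hI.1 hA.symm) (lt_of_le_of_ne hI.2 hB)] with x hx
  exact h x hx

open MeasureTheory in
theorem ae_eq_of_integral_le {f g : ℝ → ℝ} {a b : ℝ} (hab : a ≤ b)
    (hf : IntervalIntegrable f volume a b) (hg : IntervalIntegrable g volume a b)
    (hle : ∀ᵐ x, x ∈ Set.Ioc a b → f x ≤ g x) (h : ∫ x in a..b, g x ≤ ∫ x in a..b, f x) :
    ∀ᵐ x, x ∈ Set.Ioc a b → f x = g x := by
  rw [intervalIntegral.integral_of_le hab, intervalIntegral.integral_of_le hab] at h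
  have hle' := (ae_restrict_iff' measurableSet_Ioc).2 hle
  exact (ae_restrict_iff' measurableSet_Ioc).1 ((integral_eq_iff_of_ae_le hf.1 hg.1 hle').1
    (le_antisymm (integral_mono_ae hf.1 hg.1 hle') h))

open MeasureTheory in
-- Countably many translates of a null set are null, so the property holds on the whole coset `θ +
-- ℤ`, where the discrete argument can run.
theorem ae_forall_add_int {P : ℝ → Prop} (h : ∀ᵐ θ, P θ) : ∀ᵐ θ : ℝ, ∀ n : ℤ, P (θ + n) :=
  ae_all_iff.2 fun n => (measurePreserving_add_right volume (n : ℝ)).quasiMeasurePreserving.ae h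

/-- Folding `[0, K]` onto the unit interval exhibits the integral as an average of discrete sums
over all phases. -/
theorem integral_zero_natCast {h : ℝ → ℝ} (hi : ∀ a b, IntervalIntegrable h MeasureTheory.volume a b)
    (K : ℕ) : ∫ θ in (0 : ℝ)..K, h θ = ∫ φ in (0 : ℝ)..1, ∑ k ∈ Finset.range K, h (φ + k) := by
  rw [intervalIntegral.integral_finsetSum fun k _ => by
    have := (hi (0 + k) (1 + k)).comp_add_right (k : ℝ)
    simpa using this]
  have := intervalIntegral.sum_integral_adjacent_intervals (f := h) (a := fun k : ℕ => (k : ℝ))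
    (n := K) (μ := MeasureTheory.volume) fun k _ => hi _ _
  simp only [Nat.cast_zero] at this
  rw [← this]
  refine Finset.sum_congr rfl fun k _ => ?_
  rw [intervalIntegral.integral_comp_add_right h (k : ℝ)]
  push_cast
  ring_nf

/-! ### Changes of piecewise constant functions -/

/-- Just after `a` there is no breakpoint, so `g` is constant there, and a full-measure set meets
that open interval. -/
theorem IsPiecewiseConstant.eventually_add {α : Type} {g : ℝ → α} (hg : IsPiecewiseConstant g)
    {a b : ℝ} (hab : a < b) {d : α} (h : ∀ᵐ θ, θ ∈ Set.Ioo a b → g θ = d) :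
    ∀ᶠ ε in 𝓝[>] (0 : ℝ), g (a + ε) = d := by
  obtain ⟨P, hP⟩ := hg.1
  have hev : ∀ᶠ y in 𝓝[>] a, ∀ p ∈ P, ¬ (a < p ∧ p ≤ y) := by
    refine (Finset.eventually_all P).2 fun p _ => ?_
    rcases le_or_gt p a with hp | hp
    · exact Eventually.of_forall fun y hy => hp.not_gt hy.1
    · filter_upwards [Ioo_mem_nhdsGT hp] with y hy hy'
      exact hy'.2.not_gt hy.2
  obtain ⟨y, hy, hya⟩ := (hev.and (Ioo_mem_nhdsGT hab)).exists
  have hconst : ∀ x ∈ Set.Ioo a y, g x = g y := fun x hx =>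
    hP x y hx.2.le fun p hp hpx => hy p hp ⟨hx.1.trans_le hpx.1, hpx.2⟩
  obtain ⟨z, hz, hz'⟩ := (MeasureTheory.Measure.dense_of_ae h).exists_mem_open isOpen_Ioo
    (Set.nonempty_Ioo.2 hya.1)
  have hd : g y = d := (hconst z hz').symm.trans (hz ⟨hz'.1, hz'.2.trans hya.2⟩)
  filter_upwards [Ioo_mem_nhdsGT (sub_pos.2 hya.1)] with ε hε
  rw [hconst _ ⟨by linarith [hε.1], by linarith [hε.2]⟩, hd]

theorem IsPiecewiseConstant.eventually_sub {α : Type} {g : ℝ → α} (hg : IsPiecewiseConstant g)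
    {a b : ℝ} (hab : a < b) {d : α} (h : ∀ᵐ θ, θ ∈ Set.Ioo a b → g θ = d) :
    ∀ᶠ ε in 𝓝[>] (0 : ℝ), g (b - ε) = d := by
  obtain ⟨P, hP⟩ := hg.1
  have hev : ∀ᶠ y in 𝓝[<] b, ∀ p ∈ P, ¬ (y ≤ p ∧ p < b) := by
    refine (Finset.eventually_all P).2 fun p _ => ?_
    rcases le_or_gt b p with hp | hp
    · exact Eventually.of_forall fun y hy => hp.not_gt hy.2
    · filter_upwards [Ioo_mem_nhdsLT hp] with y hy hy'
      exact hy'.1.not_gt hy.1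
  obtain ⟨y, hy, hyb⟩ := (hev.and (Ioo_mem_nhdsLT hab)).exists
  have hconst : ∀ x ∈ Set.Ioo y b, g y = g x := fun x hx =>
    hP y x hx.1.le fun p hp hpx => hy p hp ⟨hpx.1, hpx.2.trans_lt hx.2⟩
  obtain ⟨z, hz, hz'⟩ := (MeasureTheory.Measure.dense_of_ae h).exists_mem_open isOpen_Ioo
    (Set.nonempty_Ioo.2 hyb.2)
  have hd : g y = d := (hconst z hz').trans (hz ⟨hyb.1.trans hz'.1, hz'.2⟩)
  filter_upwards [Ioo_mem_nhdsGT (sub_pos.2 hyb.2)] with ε hε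
  rw [← hconst _ ⟨by linarith [hε.2], by linarith [hε.1]⟩, hd]

/-- A piecewise constant function that agrees almost everywhere with a step function on the time
grid changes wherever the step function does. -/
theorem IsPiecewiseConstant.mem_changeTimes {α : Type} {g : ℝ → α} (hg : IsPiecewiseConstant g)
    {F : ℤ → α} {n : ℤ} (hF : F (n - 1) ≠ F n)
    (h : ∀ᵐ θ : ℝ, θ ∈ Set.Ioo ((n : ℝ) - 1) (n + 1) → g θ = F ⌊θ⌋) : (n : ℝ) ∈ changeTimes g := by
  have h1 := hg.eventually_sub (a := (n : ℝ) - 1) (b := n) (d := F (n - 1)) (by linarith) (by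
    filter_upwards [h] with θ hθ hI
    rw [hθ ⟨hI.1, by linarith [hI.2]⟩, show ⌊θ⌋ = n - 1 by
      rw [Int.floor_eq_iff]; push_cast; constructor <;> linarith [hI.1, hI.2]])
  have h2 := hg.eventually_add (a := (n : ℝ)) (b := n + 1) (d := F n) (by linarith) (by
    filter_upwards [h] with θ hθ hI
    rw [hθ ⟨by linarith [hI.1], hI.2⟩, show ⌊θ⌋ = n by
      rw [Int.floor_eq_iff]; constructor <;> linarith [hI.1, hI.2]])
  filter_upwards [h1, h2] with ε e1 e2
  rwa [e1, e2]

theorem measurable_comp_floor {α : Type} [MeasurableSpace α] (F : ℤ → α) :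
    Measurable fun θ : ℝ => F ⌊θ⌋ :=
  (Measurable.of_discrete (f := F)).comp Int.measurable_floor

theorem constantOutside_comp_floor {α : Type} {F : ℤ → α} {c : α} {m : ℤ}
    (hF : ∀ n, ¬ (0 ≤ n ∧ n < m) → F n = c) {b : ℝ} (hb : (m : ℝ) ≤ b) :
    ConstantOutside (fun θ : ℝ => F ⌊θ⌋) 0 b := by
  have h1 : ∀ x : ℝ, x < 0 → F ⌊x⌋ = c := fun x hx => hF _ fun h =>
    absurd (Int.floor_nonneg.1 h.1) (not_le.2 hx)
  have h2 : ∀ x : ℝ, b < x → F ⌊x⌋ = c := fun x hx => hF _ fun h =>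
    absurd (Int.floor_lt.1 h.2) (not_lt.2 (hb.trans hx.le))
  exact ⟨fun x y hx hy => (h1 x hx).trans (h1 y hy).symm,
    fun x y hx hy => (h2 x hx).trans (h2 y hy).symm⟩

namespace BinaryDelay

open DynamicNetwork MeasureTheory

variable {ℓ : ℕ}

theorem two_pow_le_encard_changeTimes {α : Type} {g : ℝ → α} (hg : IsPiecewiseConstant g)
    {b c : α} (hbc : b ≠ c) (h : ∀ᵐ θ : ℝ, θ ∈ Set.Ioo (0 : ℝ) (2 ^ (ℓ + 1)) →
      g θ = if Arrival (2 * ℓ + 1) ⌊θ⌋ then b else c) :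
    2 ^ ℓ ≤ (changeTimes g).encard := by
  refine two_pow_le_encard (ι := fun k : ℕ => (k : ℝ)) Nat.cast_injective fun k h0 hk => ?_
  have hk' : (k : ℤ) < 2 ^ (ℓ + 1) := by exact_mod_cast hk
  -- Together with `hk0` this keeps `(k - 1, k + 1)` inside the window.
  have hk1 : (k : ℝ) + 1 ≤ 2 ^ (ℓ + 1) := by exact_mod_cast hk
  have hk0 : (1 : ℝ) ≤ k := by exact_mod_cast h0
  refine hg.mem_changeTimes (n := k)
    (F := fun n => if Arrival (2 * ℓ + 1) n then b else c) ?_ ?_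
  · simp only [arrival_last (ℓ := ℓ) (n := (k : ℤ)) (by omega) hk',
      arrival_last (ℓ := ℓ) (n := (k : ℤ) - 1) (by omega) (by omega)]
    rcases Int.emod_two_eq_zero_or_one (k : ℤ) with hj | hj
    · rw [if_pos hj, if_neg (by omega)]; exact hbc.symm
    · rw [if_neg (show ¬ (k : ℤ) % 2 = 0 by omega), if_pos (by omega)]; exact hbc
  · filter_upwards [h] with θ hθ hI
    simp only [Int.cast_natCast] at hI
    exact hθ ⟨by linarith [hI.1], by linarith [hI.2]⟩

/-! ### Cuts in continuous time -/

/-- The values of a cut at the times that differ from `θ` by an integer. -/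
def phaseCut (B : ℝ) (S : Fin (2 * ℓ + 3) → ℝ → Bool) (θ : ℝ) (v : Fin (2 * ℓ + 3)) (n : ℤ) :
    Bool :=
  extendCut B S v (Int.fract θ + n)

/-- The capacity of a cut per unit of time. -/
def cutDensity (B : ℝ) (S : Fin (2 * ℓ + 3) → ℝ → Bool) (θ : ℝ) : ℝ :=
  cutStep (phaseCut B S θ) ⌊θ⌋

/-- Integer delays keep head and tail times in one coset of `ℤ`, so the integrand at `θ` is one step
of the discrete cut with phase `Int.fract θ`. -/
theorem cutCapacity_eq (A B : ℝ) (S : Fin (2 * ℓ + 3) → ℝ → Bool) :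
    (network ℓ).cutCapacity A B S = ∫ θ in A..B, cutDensity B S θ := by
  unfold cutCapacity cutDensity cutStep phaseCut extendCut
  congr 1
  funext θ
  have h : ∀ d : ℕ, Int.fract θ + ((⌊θ⌋ + d : ℤ) : ℝ) = θ + d := fun d => by
    push_cast; rw [← add_assoc, Int.fract_add_floor]
  simp only [h, Int.fract_add_floor]
  simp

theorem cutDensity_nonneg (B : ℝ) (S : Fin (2 * ℓ + 3) → ℝ → Bool) (θ : ℝ) :
    0 ≤ cutDensity B S θ := cutStep_nonneg _ _

theorem stepCap_le (e : Fin (2 * ℓ + 3) × Fin (2 * ℓ + 3)) (n : ℤ) :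
    stepCap e n ≤ 2 ^ ℓ + 1 := by
  have := Nat.one_le_two_pow (n := ℓ)
  unfold stepCap; split_ifs <;> omega

theorem cutDensity_le (B : ℝ) (S : Fin (2 * ℓ + 3) → ℝ → Bool) (θ : ℝ) :
    cutDensity B S θ ≤ ∑ _e ∈ edges ℓ, ((2 ^ ℓ + 1 : ℕ) : ℝ) :=
  (Finset.sum_le_sum_of_subset_of_nonneg (Finset.filter_subset _ _)
    fun _ _ _ => Nat.cast_nonneg _).trans
    (Finset.sum_le_sum fun e _ => Nat.cast_le.2 (stepCap_le e _))

theorem measurable_cutDensity {B : ℝ} {S : Fin (2 * ℓ + 3) → ℝ → Bool}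
    (hS : ∀ v, Measurable (S v)) : Measurable (cutDensity B S) := by
  have hset : ∀ v, MeasurableSet {θ | extendCut B S v θ = true} := fun v => by
    have : {θ | extendCut B S v θ = true} = Set.Ioi B ∪ S v ⁻¹' {true} := by
      ext θ; simp [extendCut]
    rw [this]
    exact measurableSet_Ioi.union (hS v (measurableSet_singleton true))
  unfold cutDensity cutStep phaseCut
  simp only [Finset.sum_filter]
  refine Finset.measurable_sum _ fun e _ => Measurable.ite ?_
    (measurable_comp_floor fun n => (stepCap e n : ℝ)) measurable_const
  have h : ∀ (θ : ℝ) (d : ℕ), Int.fract θ + ((⌊θ⌋ + d : ℤ) : ℝ) = θ + d := fun θ d => by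
    push_cast; rw [← add_assoc, Int.fract_add_floor]
  simp only [h, Int.fract_add_floor]
  exact (hset e.1).inter ((measurable_id.add_const (delay e : ℝ)) (hset e.2)).compl

theorem intervalIntegrable_cutDensity {B : ℝ} {S : Fin (2 * ℓ + 3) → ℝ → Bool}
    (hS : ∀ v, Measurable (S v)) (a b : ℝ) : IntervalIntegrable (cutDensity B S) volume a b :=
  intervalIntegrable_of_bounded (measurable_cutDensity hS) (fun θ => by
    rw [abs_of_nonneg (cutDensity_nonneg B S θ)]; exact cutDensity_le B S θ) a b

theorem cutDensity_add_natCast {B : ℝ} {S : Fin (2 * ℓ + 3) → ℝ → Bool} {φ : ℝ}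
    (hφ : φ ∈ Set.Ico (0 : ℝ) 1) (k : ℕ) :
    cutDensity B S (φ + k) = cutStep (phaseCut B S φ) k := by
  have h0 : ⌊φ⌋ = 0 := Int.floor_eq_zero_iff.2 hφ
  unfold cutDensity
  rw [Int.floor_add_natCast, h0, zero_add]
  unfold phaseCut
  rw [Int.fract_add_natCast]

theorem integral_arrival_last {A B : ℝ} (hA : A ≤ 0) (hB : 2 ^ (ℓ + 1) ≤ B) :
    ∫ θ in A..B, (if Arrival (2 * ℓ + 1) ⌊θ⌋ then (1 : ℝ) else 0) = 2 ^ ℓ := by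
  set F : ℝ → ℝ := fun θ => if Arrival (2 * ℓ + 1) ⌊θ⌋ then (1 : ℝ) else 0 with hF
  have hi : ∀ a b, IntervalIntegrable F volume a b := intervalIntegrable_of_bounded
    (measurable_comp_floor fun n => if Arrival (2 * ℓ + 1) n then (1 : ℝ) else 0) (C := 1)
    fun θ => by simp only [hF]; split_ifs <;> simp
  have h1 : ∫ θ in A..0, F θ = 0 := by
    refine intervalIntegral.integral_zero_ae ?_
    filter_upwards [Measure.ae_ne volume 0] with θ hθ hI
    rw [Set.uIoc_of_le hA] at hI
    exact if_neg fun h => absurd (Int.floor_nonneg.1 h.nonneg) (not_le.2 (lt_of_le_of_ne hI.2 hθ))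
  have h2 : ∫ θ in ((2 ^ (ℓ + 1) : ℕ) : ℝ)..B, F θ = 0 := by
    refine intervalIntegral.integral_zero_ae (ae_of_all _ fun θ hI => ?_)
    rw [Set.uIoc_of_le (by push_cast; exact hB)] at hI
    refine if_neg fun h => absurd (Int.floor_lt.1 (h.lt (ℓ := ℓ) (by omega))) ?_
    have := hI.1
    push_cast at this ⊢
    linarith
  rw [← intervalIntegral.integral_add_adjacent_intervals (hi A 0) (hi 0 B), h1, zero_add,
    ← intervalIntegral.integral_add_adjacent_intervals (hi 0 ((2 ^ (ℓ + 1) : ℕ) : ℝ)) (hi _ B), h2,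
    add_zero, integral_zero_natCast hi]
  rw [← sum_arrival_last (ℓ := ℓ)]
  rw [intervalIntegral.integral_congr_ae (g := fun _ => ∑ k ∈ Finset.range (2 ^ (ℓ + 1)),
    (if Arrival (2 * ℓ + 1) (k : ℤ) then (1 : ℝ) else 0))]
  · simp
  · filter_upwards [Measure.ae_ne volume 1] with φ hφ hI
    rw [Set.uIoc_of_le zero_le_one] at hI
    have h0 : ⌊φ⌋ = 0 := Int.floor_eq_zero_iff.2 ⟨hI.1.le, lt_of_le_of_ne hI.2 hφ⟩
    simp [hF, h0]

/-- The minimum cut in continuous time. -/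
def optCutReal (v : Fin (2 * ℓ + 3)) (θ : ℝ) : Bool := optCut v ⌊θ⌋

theorem optCutReal_isCut (A B : ℝ) : (network ℓ).IsCut A B optCutReal where
  measurable v := measurable_comp_floor (optCut v)
  source_mem _ _ := optCut_source _
  target_notMem _ _ := optCut_target _

theorem cutCapacity_optCutReal_le {A B : ℝ} (hA : A ≤ 0) (hB : 2 ^ (ℓ + 1) ≤ B) :
    (network ℓ).cutCapacity A B optCutReal ≤ 2 ^ ℓ := by
  have hAB : A ≤ B := hA.trans ((by positivity : (0 : ℝ) ≤ 2 ^ (ℓ + 1)).trans hB)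
  rw [cutCapacity_eq, ← integral_arrival_last hA hB]
  refine intervalIntegral.integral_mono_on hAB
    (intervalIntegrable_cutDensity (optCutReal_isCut A B).measurable _ _)
    (intervalIntegrable_of_bounded
      (measurable_comp_floor fun n => if Arrival (2 * ℓ + 1) n then (1 : ℝ) else 0) (C := 1)
      (fun θ => by split_ifs <;> simp) _ _) fun θ hθ => ?_
  rw [← cutStep_optCut]
  have hfl : ∀ n : ℤ, ⌊Int.fract θ + n⌋ = n := fun n => by simp
  refine cutStep_extend_le (fun v h => ?_) fun v m h => ?_
  · simp only [phaseCut, extendCut, Int.fract_add_floor, hθ.2.not_gt, decide_false,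
      Bool.false_or] at h
    exact h
  · simp only [phaseCut, extendCut, optCutReal, hfl, h, Bool.or_true]

/-- `sum_cutStep` applies to every phase and is integrated over the phases. A cut of capacity `2^ℓ`
is therefore optimal in almost every phase, which fixes it at almost every time of the window. -/
theorem cutCapacity_ge {A B : ℝ} (hA : A ≤ 0) (hB : 2 ^ (ℓ + 1) ≤ B)
    {R : Fin (2 * ℓ + 3) → ℝ → Bool} (hR : (network ℓ).IsCut A B R) :
    2 ^ ℓ ≤ (network ℓ).cutCapacity A B R ∧ ((network ℓ).cutCapacity A B R ≤ 2 ^ ℓ →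
      ∀ᵐ θ : ℝ, θ ∈ Set.Ioo (0 : ℝ) (2 ^ (ℓ + 1)) →
        R (lastEdge ℓ).1 θ = decide (Arrival (2 * ℓ + 1) ⌊θ⌋)) := by
  have hi := intervalIntegrable_cutDensity (B := B) hR.measurable
  have hmem : ∀ φ ∈ Set.Ico (0 : ℝ) 1, ∀ n : ℤ, 0 ≤ n → n < 2 ^ (ℓ + 1) →
      0 ≤ Int.fract φ + n ∧ Int.fract φ + n < 2 ^ (ℓ + 1) := by
    intro φ hφ n h0 h1
    have h0' : (0 : ℝ) ≤ n := by exact_mod_cast h0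
    have h1' : (n : ℝ) + 1 ≤ 2 ^ (ℓ + 1) := by exact_mod_cast h1
    have := Int.fract_nonneg φ
    have := Int.fract_lt_one φ
    constructor <;> linarith
  have key : ∀ φ ∈ Set.Ico (0 : ℝ) 1, _ := fun φ hφ => sum_cutStep (S := phaseCut B R φ)
    (fun n h0 h => by
      obtain ⟨m1, m2⟩ := hmem φ hφ n h0 h
      have := hR.source_mem (Int.fract φ + n) ⟨by linarith, by linarith⟩
      rw [network_source] at this
      simp [phaseCut, extendCut, this])
    (fun n h0 h => by
      obtain ⟨m1, m2⟩ := hmem φ hφ n h0 h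
      have := hR.target_notMem (Int.fract φ + n) ⟨by linarith, by linarith⟩
      rw [network_target] at this
      simp only [phaseCut, extendCut, this, Bool.or_false, decide_eq_false_iff_not]
      linarith)
  set H : ℝ → ℝ := fun φ => ∑ k ∈ Finset.range (2 ^ (ℓ + 1)), cutDensity B R (φ + k) with hH
  have hHeq : ∀ φ ∈ Set.Ico (0 : ℝ) 1,
      H φ = ∑ k ∈ Finset.range (2 ^ (ℓ + 1)), cutStep (phaseCut B R φ) k := fun φ hφ =>
    Finset.sum_congr rfl fun k _ => cutDensity_add_natCast hφ k
  have hHi : IntervalIntegrable H volume 0 1 := by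
    have := IntervalIntegrable.sum (Finset.range (2 ^ (ℓ + 1))) (μ := volume) (a := 0) (b := 1)
      (f := fun k φ => cutDensity B R (φ + (k : ℝ))) fun k _ => by
        have := (hi (0 + k) (1 + k)).comp_add_right (k : ℝ)
        simpa using this
    rwa [show (∑ k ∈ Finset.range (2 ^ (ℓ + 1)), fun φ : ℝ => cutDensity B R (φ + (k : ℝ))) = H by
      funext φ; simp [hH]] at this
  have hle : ∀ᵐ φ : ℝ, φ ∈ Set.Ioc (0 : ℝ) 1 → (2 : ℝ) ^ ℓ ≤ H φ := by
    filter_upwards [Measure.ae_ne volume 1] with φ hφ hI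
    have hI' : φ ∈ Set.Ico (0 : ℝ) 1 := ⟨hI.1.le, lt_of_le_of_ne hI.2 hφ⟩
    rw [hHeq φ hI']
    exact (key φ hI').1
  have hcap : ∫ φ in (0 : ℝ)..1, H φ ≤ (network ℓ).cutCapacity A B R := by
    rw [cutCapacity_eq, ← integral_zero_natCast hi]
    exact intervalIntegral.integral_mono_interval hA (by positivity) (by push_cast; exact hB)
      (ae_of_all _ fun θ => cutDensity_nonneg B R θ) (hi A B)
  have hconst : ∫ _ in (0 : ℝ)..1, (2 : ℝ) ^ ℓ = 2 ^ ℓ := by simp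
  refine ⟨?_, fun hsmall => ?_⟩
  · refine le_trans ?_ hcap
    rw [← hconst]
    refine intervalIntegral.integral_mono_ae_restrict zero_le_one intervalIntegrable_const hHi ?_
    rw [← restrict_Ioc_eq_restrict_Icc]
    exact (ae_restrict_iff' measurableSet_Ioc).2 hle
  · have heq := ae_eq_of_integral_le zero_le_one intervalIntegrable_const hHi hle
      (by rw [hconst]; exact hcap.trans hsmall)
    -- Translation by `-⌊θ⌋` brings `θ` to its phase. Phase `0` is discarded because `heq` speaks
    -- about `(0, 1]` while phases lie in `[0, 1)`.
    filter_upwards [ae_forall_add_int (heq.and (Measure.ae_ne volume 0))] with θ hθ hI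
    obtain ⟨h1, h2⟩ := hθ (-⌊θ⌋)
    have hfr : θ + ((-⌊θ⌋ : ℤ) : ℝ) = Int.fract θ := by
      push_cast; rw [← sub_eq_add_neg, Int.self_sub_floor]
    rw [hfr] at h1 h2
    have hIco : Int.fract θ ∈ Set.Ico (0 : ℝ) 1 := ⟨Int.fract_nonneg θ, Int.fract_lt_one θ⟩
    have h3 := h1 ⟨lt_of_le_of_ne hIco.1 h2.symm, hIco.2.le⟩
    rw [hHeq _ hIco] at h3
    obtain ⟨k, hk⟩ := Int.eq_ofNat_of_zero_le (Int.floor_nonneg.2 hI.1.le)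
    have hk2 : k < 2 ^ (ℓ + 1) := by
      have h5 : ⌊θ⌋ < 2 ^ (ℓ + 1) := Int.floor_lt.2 (by push_cast; exact hI.2)
      rw [hk] at h5
      exact_mod_cast h5
    have h4 := (key _ hIco).2 h3.symm.le k hk2
    rw [← hk] at h4
    simp only [phaseCut, extendCut, Int.fract_fract, Int.fract_add_floor,
      (hI.2.le.trans hB).not_gt, decide_false, Bool.false_or] at h4
    exact h4

theorem optCutReal_isMinCut {A B : ℝ} (hA : A ≤ 0) (hB : 2 ^ (ℓ + 1) ≤ B) :
    (network ℓ).IsMinCut A B optCutReal :=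
  ⟨optCutReal_isCut A B, fun _ hR =>
    (cutCapacity_optCutReal_le hA hB).trans (cutCapacity_ge hA hB hR).1⟩

theorem exists_isMinCutInfinite : ∃ S, (network ℓ).IsMinCutInfinite S := by
  refine ⟨optCutReal, fun v => ?_, 0, 2 ^ (ℓ + 1), by positivity, fun v => ?_, fun a' b' ha hb =>
    ⟨a', b', le_rfl, le_rfl, optCutReal, optCutReal_isMinCut ha hb, fun _ _ _ => rfl⟩⟩ <;>
  obtain ⟨c, hc⟩ := optCut_constantOutside v
  · exact isPiecewiseConstant_comp_floor hc
  · exact constantOutside_comp_floor hc (by push_cast; exact le_rfl)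

theorem two_pow_le_cutComplexity {S : Fin (2 * ℓ + 3) → ℝ → Bool}
    (hS : (network ℓ).IsMinCutInfinite S) : 2 ^ ℓ ≤ cutComplexity S := by
  obtain ⟨hpc, a, b, hab, -, h⟩ := hS
  obtain ⟨A, B, hA, hB, R, hR, hRS⟩ := h (min a 0) (max b (2 ^ (ℓ + 1))) (min_le_left _ _)
    (le_max_left _ _)
  have hA' : A ≤ 0 := hA.trans (min_le_right _ _)
  have hB' : 2 ^ (ℓ + 1) ≤ B := (le_max_right _ _).trans hB
  have hval := (cutCapacity_ge hA' hB' hR.1).2 ((hR.2 _ (optCutReal_isCut A B)).trans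
    (cutCapacity_optCutReal_le hA' hB'))
  refine (two_pow_le_encard_changeTimes (hpc (lastEdge ℓ).1) (b := true) (c := false) (by simp)
    ?_).trans (Finset.single_le_sum (f := fun v => (changeTimes (S v)).encard)
      (fun _ _ => zero_le) (Finset.mem_univ _))
  filter_upwards [hval] with θ hθ hI
  rw [← hRS _ _ ⟨(min_le_right _ _).trans hI.1.le, hI.2.le.trans (le_max_right _ _)⟩, hθ hI]
  split_ifs with h <;> simp [h]

/-! ### Flows in continuous time -/

/-- The maximum flow in continuous time. -/
def optFlowReal (e : Fin (2 * ℓ + 3) × Fin (2 * ℓ + 3)) (θ : ℝ) : ℝ := optFlow e ⌊θ⌋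

theorem optFlowReal_isFlow {A B : ℝ} (hA : A ≤ 0) (hB : 2 ^ (ℓ + 2) ≤ B) :
    (network ℓ).IsFlow A B optFlowReal where
  measurable e _ := measurable_comp_floor (optFlow e)
  zero_outside e he θ hn := by
    by_contra h
    obtain ⟨h1, h2⟩ := optFlow_ne_zero h
    have h3 : ((delay e : ℕ) : ℝ) ≤ 2 ^ ℓ := by exact_mod_cast delay_le he
    have h1' := Int.floor_nonneg.1 h1
    have h2' := Int.floor_lt.1 h2
    have hp : (0 : ℝ) < 2 ^ ℓ := by positivity
    rw [network_transit] at hn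
    rw [pow_succ, pow_succ] at hB
    push_cast at h2'
    rw [pow_succ] at h2'
    exact hn ⟨by linarith, by linarith⟩
  nonneg e _ θ := optFlow_nonneg e _
  le_cap e he θ _ := optFlow_le_cap he _
  conservation v h0 hl θ _ := by
    unfold excess
    have : ∀ ζ : ℝ, (∑ e ∈ (network ℓ).edges with e.2 = v,
        optFlowReal e (ζ - (network ℓ).transit e)) -
          ∑ e ∈ (network ℓ).edges with e.1 = v, optFlowReal e ζ = 0 := fun ζ => by
      simp only [optFlowReal, network_transit, network_edges, Int.floor_sub_natCast]
      rw [optFlow_conservation h0 hl, sub_self]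
    simp only [this, intervalIntegral.integral_zero]

theorem excess_target (A B : ℝ) (f : Fin (2 * ℓ + 3) × Fin (2 * ℓ + 3) → ℝ → ℝ) :
    (network ℓ).excess A f (network ℓ).target B = ∫ θ in A..B, f (lastEdge ℓ) θ := by
  show ∫ θ in A..B, ((∑ e ∈ edges ℓ with e.2 = Fin.last (2 * ℓ + 2),
    f e (θ - (network ℓ).transit e)) - ∑ e ∈ edges ℓ with e.1 = Fin.last _, f e θ) = _
  rw [filter_snd_target, filter_fst_target]
  simp

theorem IsFlow_le {A B : ℝ} {g : Fin (2 * ℓ + 3) × Fin (2 * ℓ + 3) → ℝ → ℝ}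
    (hg : (network ℓ).IsFlow A B g) {e : Fin (2 * ℓ + 3) × Fin (2 * ℓ + 3)} (he : e ∈ edges ℓ)
    (θ : ℝ) : g e θ ≤ stepCap e ⌊θ⌋ := by
  by_cases h : θ ∈ Set.Icc A (B - (network ℓ).transit e)
  · exact hg.le_cap e he θ h
  · rw [hg.zero_outside e he θ h]; exact Nat.cast_nonneg _

theorem IsFlow_abs_le {A B : ℝ} {g : Fin (2 * ℓ + 3) × Fin (2 * ℓ + 3) → ℝ → ℝ}
    (hg : (network ℓ).IsFlow A B g) {e : Fin (2 * ℓ + 3) × Fin (2 * ℓ + 3)} (he : e ∈ edges ℓ)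
    (θ : ℝ) : |g e θ| ≤ ((2 ^ ℓ + 1 : ℕ) : ℝ) := by
  rw [abs_of_nonneg (hg.nonneg e he θ)]
  exact (IsFlow_le hg he θ).trans (Nat.cast_le.2 (stepCap_le e _))

theorem IsFlow_intervalIntegrable {A B : ℝ} {g : Fin (2 * ℓ + 3) × Fin (2 * ℓ + 3) → ℝ → ℝ}
    (hg : (network ℓ).IsFlow A B g) {e : Fin (2 * ℓ + 3) × Fin (2 * ℓ + 3)} (he : e ∈ edges ℓ)
    (a b : ℝ) : IntervalIntegrable (g e) volume a b :=
  intervalIntegrable_of_bounded (hg.measurable e he) (IsFlow_abs_le hg he) a b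

/-- The excess vanishes identically, hence so does its derivative almost everywhere; finitely many
vertices share one null set. -/
theorem IsFlow_ae_conservation {A B : ℝ} (hAB : A ≤ B)
    {g : Fin (2 * ℓ + 3) × Fin (2 * ℓ + 3) → ℝ → ℝ} (hg : (network ℓ).IsFlow A B g) :
    ∀ᵐ θ : ℝ, ∀ v, v ≠ 0 → v ≠ Fin.last _ → θ ∈ Set.Icc A B →
      ∑ e ∈ edges ℓ with e.2 = v, g e (θ - delay e) = ∑ e ∈ edges ℓ with e.1 = v, g e θ := by
  refine ae_all_iff.2 fun v => ?_
  by_cases h0 : v = 0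
  · exact ae_of_all _ fun θ h => absurd h0 h
  by_cases hl : v = Fin.last _
  · exact ae_of_all _ fun θ _ h => absurd hl h
  have hmem : ∀ {p : Fin (2 * ℓ + 3) × Fin (2 * ℓ + 3) → Prop} [DecidablePred p],
      ∀ e ∈ (edges ℓ).filter p, e ∈ edges ℓ := fun e he => (Finset.mem_filter.1 he).1
  have hint : IntervalIntegrable (fun θ => (∑ e ∈ edges ℓ with e.2 = v, g e (θ - delay e)) -
      ∑ e ∈ edges ℓ with e.1 = v, g e θ) volume A B := by
    refine intervalIntegrable_of_bounded
      ((Finset.measurable_sum _ fun e he => (hg.measurable e (hmem e he)).comp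
        (measurable_id.sub_const _)).sub
        (Finset.measurable_sum _ fun e he => hg.measurable e (hmem e he)))
      (C := (∑ e ∈ edges ℓ with e.2 = v, ((2 ^ ℓ + 1 : ℕ) : ℝ)) +
        ∑ e ∈ edges ℓ with e.1 = v, ((2 ^ ℓ + 1 : ℕ) : ℝ)) (fun θ => ?_) A B
    refine (abs_sub _ _).trans (add_le_add ?_ ?_) <;>
    exact (Finset.abs_sum_le_sum_abs _ _).trans
      (Finset.sum_le_sum fun e he => IsFlow_abs_le hg (hmem e he) _)
  filter_upwards [ae_eq_zero_of_integral_eq_zero hAB hint (hg.conservation v h0 hl)]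
    with θ hθ _ _ hI
  exact sub_eq_zero.1 (hθ hI)

/-- For almost every `θ` conservation holds along `θ + ℤ`, so the flow restricted to this coset
obeys the discrete argument. -/
theorem IsFlow_last_le {A B : ℝ} (hAB : A ≤ B)
    {g : Fin (2 * ℓ + 3) × Fin (2 * ℓ + 3) → ℝ → ℝ} (hg : (network ℓ).IsFlow A B g) :
    ∀ᵐ θ, g (lastEdge ℓ) θ ≤ optFlowReal (lastEdge ℓ) θ := by
  filter_upwards [ae_forall_add_int (IsFlow_ae_conservation hAB hg)] with θ hθ
  by_cases h : g (lastEdge ℓ) θ = 0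
  · rw [h]; exact optFlow_nonneg _ _
  have hin : ∀ e ∈ edges ℓ, ∀ θ, g e θ ≠ 0 → θ ∈ Set.Icc A (B - (network ℓ).transit e) :=
    fun e he n hn => by_contra fun h => hn (hg.zero_outside e he n h)
  have hphase : ∀ n : ℤ, Int.fract θ + n = θ + ((n - ⌊θ⌋ : ℤ) : ℝ) := fun n => by
    rw [Int.fract]; push_cast; ring
  have harr := arrival_of_flow_ne_zero (g := fun e n => g e (Int.fract θ + n))
    (fun e he n => hg.nonneg e he _) (fun e he h0 n hn => by
      by_contra hne
      have h1 := IsFlow_le hg he (Int.fract θ + n)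
      have hfl : ⌊Int.fract θ + n⌋ = n := by simp
      simp only [stepCap, h0, Fin.val_zero, if_true, hfl, hne, if_false, Nat.cast_zero] at h1
      exact hn (le_antisymm h1 (hg.nonneg e he _))) (fun v h0 hl n ⟨e, he, _, hn⟩ => by
      have h1 := hin e he _ hn
      have h2 : Int.fract θ + n ∈ Set.Icc A B := ⟨h1.1, h1.2.trans (by simp)⟩
      have h3 := hθ (n - ⌊θ⌋) v h0 hl (by rwa [← hphase])
      rw [← hphase] at h3
      simpa [add_sub_assoc] using h3) lastEdge_mem (n := ⌊θ⌋)
      (by simpa only [Int.fract_add_floor] using h)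
  have h1 := IsFlow_le hg lastEdge_mem θ
  unfold optFlowReal
  rw [optFlow_lastEdge, if_pos (by simpa [lastEdge] using harr)]
  simpa [stepCap_lastEdge] using h1

theorem excess_target_le {A B : ℝ} (hA : A ≤ 0) (hB : 2 ^ (ℓ + 2) ≤ B)
    {g : Fin (2 * ℓ + 3) × Fin (2 * ℓ + 3) → ℝ → ℝ} (hg : (network ℓ).IsFlow A B g) :
    (network ℓ).excess A g (network ℓ).target B ≤
      (network ℓ).excess A optFlowReal (network ℓ).target B := by
  have hAB : A ≤ B := hA.trans ((by positivity : (0 : ℝ) ≤ 2 ^ (ℓ + 2)).trans hB)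
  rw [excess_target, excess_target]
  exact intervalIntegral.integral_mono_ae hAB (IsFlow_intervalIntegrable hg lastEdge_mem _ _)
    (IsFlow_intervalIntegrable (optFlowReal_isFlow hA hB) lastEdge_mem _ _) (IsFlow_last_le hAB hg)

theorem optFlowReal_isMaxFlow {A B : ℝ} (hA : A ≤ 0) (hB : 2 ^ (ℓ + 2) ≤ B) :
    (network ℓ).IsMaxFlow A B optFlowReal :=
  ⟨optFlowReal_isFlow hA hB, fun _ hg => excess_target_le hA hB hg⟩

theorem exists_isMaxFlowInfinite : ∃ f, (network ℓ).IsMaxFlowInfinite f := by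
  have h0 : ∀ e : Fin (2 * ℓ + 3) × Fin (2 * ℓ + 3), ∀ n, ¬ (0 ≤ n ∧ n < 2 ^ (ℓ + 1)) →
      optFlow e n = 0 := fun e n hn => by_contra fun h => hn (optFlow_ne_zero h)
  refine ⟨optFlowReal, fun e _ => isPiecewiseConstant_comp_floor (h0 e), 0, 2 ^ (ℓ + 2),
    by positivity, fun e _ => constantOutside_comp_floor (h0 e) ?_, fun a' b' ha hb =>
    ⟨a', b', le_rfl, le_rfl, optFlowReal, optFlowReal_isMaxFlow ha hb, fun _ _ _ _ => rfl⟩⟩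
  push_cast
  exact pow_le_pow_right₀ (by norm_num) (by omega)

theorem two_pow_le_flowComplexity {f : Fin (2 * ℓ + 3) × Fin (2 * ℓ + 3) → ℝ → ℝ}
    (hf : (network ℓ).IsMaxFlowInfinite f) : 2 ^ ℓ ≤ (network ℓ).flowComplexity f := by
  obtain ⟨hpc, a, b, hab, -, h⟩ := hf
  obtain ⟨A, B, hA, hB, g, hg, hgf⟩ := h (min a 0) (max b (2 ^ (ℓ + 2))) (min_le_left _ _)
    (le_max_left _ _)
  have hA' : A ≤ 0 := hA.trans (min_le_right _ _)
  have hB' : 2 ^ (ℓ + 2) ≤ B := (le_max_right _ _).trans hB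
  have hAB : A ≤ B := hA'.trans ((by positivity : (0 : ℝ) ≤ 2 ^ (ℓ + 2)).trans hB')
  have hp : (2 : ℝ) ^ (ℓ + 1) ≤ 2 ^ (ℓ + 2) := pow_le_pow_right₀ (by norm_num) (by omega)
  have hopt := optFlowReal_isFlow (ℓ := ℓ) hA' hB'
  have hmax := hg.2 _ hopt
  rw [excess_target, excess_target] at hmax
  have hval := ae_eq_of_integral_le hAB (IsFlow_intervalIntegrable hg.1 lastEdge_mem _ _)
    (IsFlow_intervalIntegrable hopt lastEdge_mem _ _)
    ((IsFlow_last_le hAB hg.1).mono fun _ h _ => h) hmax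
  refine (two_pow_le_encard_changeTimes (hpc (lastEdge ℓ) lastEdge_mem) (b := 1) (c := 0) (by simp)
    ?_).trans (Finset.single_le_sum (f := fun e => (changeTimes (f e)).encard)
      (fun _ _ => zero_le) lastEdge_mem)
  filter_upwards [hval] with θ hθ hI
  have hI2 := hI.2.le.trans hp
  rw [← hgf _ lastEdge_mem _ ⟨(min_le_right _ _).trans hI.1.le, hI2.trans (le_max_right _ _)⟩,
    hθ ⟨hA'.trans_lt hI.1, hI2.trans hB'⟩]
  exact optFlow_lastEdge _

end BinaryDelay

end

theorem mainTheorem6 :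
    ∃ p : Polynomial ℕ, ∀ ℓ : ℕ,
      ∃ (V : Type) (_ : Fintype V) (_ : DecidableEq V) (N : DynamicNetwork V),
        N.IsAcyclic ∧ N.numCapacityChanges = 2 ∧ N.IsDiscrete ∧ N.HasSizeAtMost (p.eval ℓ) ∧
        -- continuous time
        (∃ S, N.IsMinCutInfinite S) ∧
        (∃ f, N.IsMaxFlowInfinite f) ∧
        (∀ S, N.IsMinCutInfinite S → 2 ^ ℓ ≤ cutComplexity S) ∧
        (∀ f, N.IsMaxFlowInfinite f → 2 ^ ℓ ≤ N.flowComplexity f) ∧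
        -- discrete time
        (∃ S, N.IsMinDCutInfinite S) ∧
        (∃ f, N.IsMaxDFlowInfinite f) ∧
        (∀ S, N.IsMinDCutInfinite S → 2 ^ ℓ ≤ dCutComplexity S) ∧
        (∀ f, N.IsMaxDFlowInfinite f → 2 ^ ℓ ≤ N.dFlowComplexity f) := by
  -- The number of vertices; it also bounds the digits, since the largest number `2^ℓ + 1` has at
  -- most `ℓ + 2`.
  refine ⟨2 * Polynomial.X + 3, fun ℓ => ⟨Fin (2 * ℓ + 3), inferInstance, inferInstance,
    BinaryDelay.network ℓ, BinaryDelay.network_isAcyclic, BinaryDelay.network_numCapacityChanges,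
    BinaryDelay.network_isDiscrete, ?_, BinaryDelay.exists_isMinCutInfinite,
    BinaryDelay.exists_isMaxFlowInfinite, fun _ => BinaryDelay.two_pow_le_cutComplexity,
    fun _ => BinaryDelay.two_pow_le_flowComplexity, BinaryDelay.exists_isMinDCutInfinite,
    BinaryDelay.exists_isMaxDFlowInfinite, fun _ => BinaryDelay.two_pow_le_dCutComplexity,
    fun _ => BinaryDelay.two_pow_le_dFlowComplexity⟩⟩
  have h : (2 * Polynomial.X + 3 : Polynomial ℕ).eval ℓ = 2 * ℓ + 3 := by simp
  rw [h]
  exact BinaryDelay.network_hasSizeAtMost
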